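/- Let $\mathbb R\times\mathbb R_+=\{(x_1,x_2)\in\mathbb R^2: x_2>0\}$, $A_0(x_1,x_2)=\tfrac12(-x_2,x_1)$, and $$H^1_{A_0}(\mathbb R\times\mathbb R_+)=\{u\in L^2(\mathbb R\times\mathbb R_+;\mathbb C):\ (\nabla-iA_0)u\in L^2(\mathbb R\times\mathbb R_+)\},$$ with $\nabla$ taken in the sense of distributions. For $\gamma\in\mathbb R$ let $$\Theta(\gamma)=\inf_{u\in H^1_{A_0}(\mathbb R\times\mathbb R_+),\ u\neq0}\ \frac{\|(\nabla-iA_0)u\|^2_{L^2(\mathbb R\times\mathbb R_+)}+\gamma\int_{\mathbb R}|u(x_1,0)|^2\,dx_1}{\|u\|^2_{L^2(\mathbb R\times\mathbb R_+)}},$$ where $u(\cdot,0)\in L^2(\mathbb R)$ is the boundary trace of $u$. Then for every $\gamma\in\mathbb R$ this infimum is finite, and there exist constants $C_0,\gamma_0>0$ such that $$1-C_0\,\gamma\,e^{-\gamma^2}\le\Theta(\gamma)<1\qquad\text{for all }\gamma\in[\gamma_0,+\infty),$$ and $$-\gamma^2\le\Theta(\gamma)\le-\gamma^2+\frac1{4\gamma^2}\qquad\text{for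 all }\gamma\in(-\infty,0).$$ -/

import Mathlib

open MeasureTheory Set
open scoped ContDiff

noncomputable section

namespace RobinHalfPlane

/-- The open half-plane `ℝ × ℝ₊ = {(x₁, x₂) : x₂ > 0}`. -/
def halfPlane : Set (ℝ × ℝ) := {x | 0 < x.2}

/-- Lebesgue measure on the half-plane. -/
def vol : Measure (ℝ × ℝ) := volume.restrict halfPlane

/-- First component of the magnetic potential `A₀(x₁, x₂) = ½ (-x₂, x₁)`. -/
def A₁ (x : ℝ × ℝ) : ℝ := -x.2 / 2

/-- Second component of the magnetic potential `A₀(x₁, x₂) = ½ (-x₂, x₁)`. -/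
def A₂ (x : ℝ × ℝ) : ℝ := x.1 / 2

/-- The partial derivative `∂φ/∂x₁`. -/
def pd₁ (φ : ℝ × ℝ → ℂ) (x : ℝ × ℝ) : ℂ := fderiv ℝ φ x (1, 0)

/-- The partial derivative `∂φ/∂x₂`. -/
def pd₂ (φ : ℝ × ℝ → ℂ) (x : ℝ × ℝ) : ℂ := fderiv ℝ φ x (0, 1)

/-- `(v₁, v₂) = (∇ - i A₀) u` in the sense of distributions on the open half-plane: the equality
is tested against all smooth functions with compact support in the open half-plane. -/
def IsMagneticGradient (u v₁ v₂ : ℝ × ℝ → ℂ) : Prop :=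
  ∀ φ : ℝ × ℝ → ℂ, ContDiff ℝ ∞ φ → HasCompactSupport φ → tsupport φ ⊆ halfPlane →
    (∫ x, v₁ x * φ x ∂vol = -∫ x, u x * (pd₁ φ x + Complex.I * (A₁ x : ℂ) * φ x) ∂vol) ∧
    (∫ x, v₂ x * φ x ∂vol = -∫ x, u x * (pd₂ φ x + Complex.I * (A₂ x : ℂ) * φ x) ∂vol)

/-- `u` belongs to `H¹_{A₀}(ℝ × ℝ₊)` and its magnetic gradient `(∇ - i A₀) u ∈ L²` is
`(v₁, v₂)`. -/
structure MemMagneticH1 (u v₁ v₂ : ℝ × ℝ → ℂ) : Prop where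
  memLp : MemLp u 2 vol
  memLp₁ : MemLp v₁ 2 vol
  memLp₂ : MemLp v₂ 2 vol
  isMagneticGradient : IsMagneticGradient u v₁ v₂

/-- `g = u(·, 0) ∈ L²(ℝ)` is the boundary trace of the function `u`, where
`v₂ = (∂₂ - i A₂) u`. The trace is the unique (up to null sets) `g` for which integration by parts
in the variable `x₂` holds against test functions that need not vanish on the boundary. -/
structure IsTrace (u v₂ : ℝ × ℝ → ℂ) (g : ℝ → ℂ) : Prop where
  memLp : MemLp g 2 volume
  green : ∀ φ : ℝ × ℝ → ℂ, ContDiff ℝ ∞ φ → HasCompactSupport φ →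
    ∫ x, v₂ x * φ x ∂vol =
      -(∫ x, u x * (pd₂ φ x + Complex.I * (A₂ x : ℂ) * φ x) ∂vol) - ∫ s : ℝ, g s * φ (s, 0)

/-- The set of all Rayleigh quotients
`(‖(∇ - i A₀) u‖² + γ ∫ |u(x₁, 0)|² dx₁) / ‖u‖²` for nonzero `u ∈ H¹_{A₀}(ℝ × ℝ₊)`. -/
def rayleighQuotients (γ : ℝ) : Set ℝ :=
  {r | ∃ (u v₁ v₂ : ℝ × ℝ → ℂ) (g : ℝ → ℂ),
    MemMagneticH1 u v₁ v₂ ∧ IsTrace u v₂ g ∧ ¬ (u =ᵐ[vol] 0) ∧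
    r = ((∫ x, (‖v₁ x‖ ^ 2 + ‖v₂ x‖ ^ 2) ∂vol) + γ * ∫ s : ℝ, ‖g s‖ ^ 2) /
      ∫ x, ‖u x‖ ^ 2 ∂vol}

/-- `Θ(γ)`, the infimum of the Rayleigh quotients. -/
def Theta (γ : ℝ) : ℝ := sInf (rayleighQuotients γ)

end RobinHalfPlane

end

/-! Lower bound for large γ. A gauge change turns the symmetric potential into the Landau potential,
and a Fourier transform in x₁ splits the form into the half-line oscillators ∫ (|h'|² + (t-ξ)²|h|²)
+ γ|h(0)|², with centre ξ = -2πk at frequency k. Each is bounded below, uniformly in ξ, through a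
Riccati function: if W² - W' ≤ V and W(0) ≥ -γ, completing the square gives ∫ (|h'|² + V|h|²) +
γ|h(0)|² ≥ 0 for h vanishing far out (`picone`). For V = (t-ξ)² - 1 the choice W = t-ξ, minus the
logarithmic derivative of the Gaussian, works when ξ ≤ γ. When ξ > γ its value at 0 is too small,
and an explicit correction on [0, ξ] repairs it at the cost of lowering the level 1 by 4γ exp(-γ²)
(`exists_riccati`, `robin_oscillator_bound`).

This argument concerns smooth compactly supported functions (`magnetic_bound_of_contDiff`). It
extends to the whole form domain because such functions, not required to vanish on the boundary, are
dense (`exists_seq_approx`), and because along an approximating sequence the boundary norms converge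
to that of the trace (`trace_norm_sq`).

Lower bound -γ². The trace satisfies ∫|g|² = -2 Re ∫ v₂ ū (`trace_identity`), so the form equals
‖v₁‖² + ‖v₂ - γu‖² - γ²‖u‖².

Upper bounds. A plane wave in the Landau gauge with a wide Gaussian envelope has as quotient the
one-dimensional quotient of its normal profile, plus an arbitrarily small ε
(`wavePacket_quotient_mem`). The profile exp(γt), with the oscillator centred at the mean of its
squared density, gives -γ² + 1/(4γ²). A Gaussian centred at γ + 1 gives a value strictly below 1. -/

noncomputable section

namespace RobinHalfPlane

/-! ### Riccati bounds for Robin oscillators on the half-line -/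

/-- Picone-type inequality: a Riccati supersolution `W` bounds the Schrödinger energy from below by
boundary terms. -/
theorem picone {h h' : ℝ → ℂ} {W W' V : ℝ → ℝ} {a b : ℝ} (hab : a ≤ b)
    (hh : ∀ t, HasDerivAt h (h' t) t) (hc : Continuous h')
    (hW : ∀ t ∈ Icc a b, HasDerivAt W (W' t) t) (hWc : ContinuousOn W' (Icc a b))
    (hV : Continuous V) (hWV : ∀ t ∈ Icc a b, W t ^ 2 - W' t ≤ V t) :
    W a * ‖h a‖ ^ 2 - W b * ‖h b‖ ^ 2 ≤ ∫ t in a..b, (‖h' t‖ ^ 2 + V t * ‖h t‖ ^ 2) := by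
  have hhc : Continuous h := continuous_iff_continuousAt.2 fun t => (hh t).continuousAt
  have hWcont : ContinuousOn W (Icc a b) := fun t ht => (hW t ht).continuousAt.continuousWithinAt
  set F' : ℝ → ℝ := fun t => W' t * ‖h t‖ ^ 2 + W t * (2 * inner ℝ (h t) (h' t)) with hF'
  have hF : ∀ t ∈ Icc a b, HasDerivAt (fun t => W t * ‖h t‖ ^ 2) (F' t) t := fun t ht =>
    (hW t ht).mul (hh t).norm_sq
  have hF'c : ContinuousOn F' (Icc a b) :=
    (hWc.mul (hhc.norm.pow 2).continuousOn).add
      (hWcont.mul ((continuous_const.mul (hhc.inner hc)).continuousOn))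
  have hFi : IntervalIntegrable F' volume a b :=
    ContinuousOn.intervalIntegrable (by rwa [uIcc_of_le hab])
  have hint := intervalIntegral.integral_eq_sub_of_hasDerivAt (by rwa [uIcc_of_le hab]) hFi
  have hG : Continuous fun t => ‖h' t‖ ^ 2 + V t * ‖h t‖ ^ 2 := by fun_prop
  have hmono := intervalIntegral.integral_mono_on hab hFi.neg (hG.intervalIntegrable a b)
    (fun t ht => ?_)
  · simp only [Pi.neg_apply, intervalIntegral.integral_neg, hint] at hmono
    linarith
  -- Expanding this square gives -(W|h|²)' ≤ |h'|² + (W² - W')|h|².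
  · have h1 : 0 ≤ ‖h' t + (W t) • h t‖ ^ 2 := by positivity
    rw [norm_add_sq_real, norm_smul, mul_pow, inner_smul_right, Real.norm_eq_abs, sq_abs,
      real_inner_comm] at h1
    have h2 := mul_le_mul_of_nonneg_right (hWV t ht) (sq_nonneg ‖h t‖)
    simp only [Pi.neg_apply, hF']
    nlinarith

/-- The elementary estimate that fixes the size of the exponentially small error. -/
theorem sq_mul_sub_le_exp {γ ξ : ℝ} (hγ : 1 ≤ γ) (hξ : γ ≤ ξ) :
    ξ ^ 2 * (ξ - γ) ≤ γ ^ 2 * Real.exp (ξ ^ 2 - γ ^ 2) := by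
  obtain ⟨η, rfl⟩ : ∃ η, ξ = γ + η := ⟨ξ - γ, by ring⟩
  have hη : 0 ≤ η := by linarith
  have hx : 0 ≤ (γ + η) ^ 2 - γ ^ 2 := by nlinarith
  have h1 := Real.quadratic_le_exp_of_nonneg hx
  set x := (γ + η) ^ 2 - γ ^ 2 with hxdef
  have hx' : x = 2 * γ * η + η ^ 2 := by rw [hxdef]; ring
  have h2 : γ ^ 2 * (1 + x + x ^ 2 / 2) ≤ γ ^ 2 * Real.exp x :=
    mul_le_mul_of_nonneg_left h1 (by positivity)
  refine le_trans ?_ h2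
  -- In the nonnegative variables k = γ - 1 and η = ξ - γ, the quadratic Taylor bound for the
  -- exponential reduces the claim to a sum of nonnegative terms.
  obtain ⟨k, rfl⟩ : ∃ k, γ = 1 + k := ⟨γ - 1, by ring⟩
  have hk : 0 ≤ k := by linarith
  rw [hx', ← sub_nonneg]
  have : (1 + k) ^ 2 * (1 + (2 * (1 + k) * η + η ^ 2) + (2 * (1 + k) * η + η ^ 2) ^ 2 / 2)
      - (1 + k + η) ^ 2 * (1 + k + η - (1 + k)) =
      (1 + k) ^ 2 + (1 + k) ^ 2 * η * (1 + 2 * k) + (1 + k) ^ 2 * η ^ 2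
        + 2 * (1 + k) * η ^ 2 * ((1 + k) ^ 2 * (1 + k) - 1)
        + η ^ 3 * (2 * (1 + k) ^ 3 - 1) + (1 + k) ^ 2 * η ^ 4 / 2 := by ring
  rw [this]
  have e1 : 0 ≤ (1 + k) ^ 2 * (1 + k) - 1 := by
    have : (1 + k) ^ 2 * (1 + k) - 1 = 3 * k + 3 * k ^ 2 + k ^ 3 := by ring
    rw [this]; positivity
  have e2 : 0 ≤ 2 * (1 + k) ^ 3 - 1 := by nlinarith
  positivity

/-- A Riccati supersolution for the shifted harmonic oscillator with centre `ξ > γ`. -/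
theorem exists_riccati {γ ξ : ℝ} (hγ : 1 ≤ γ) (hξ : γ < ξ) :
    ∃ W W' : ℝ → ℝ, (∀ t, HasDerivAt W (W' t) t) ∧ Continuous W' ∧ -γ ≤ W 0 ∧ W ξ = 0 ∧
      ∀ t ∈ Icc 0 ξ, W t ^ 2 - W' t ≤ (t - ξ) ^ 2 - (1 - 4 * γ * Real.exp (-γ ^ 2)) := by
  have hγ0 : 0 < γ := by linarith
  have hξ0 : 0 < ξ := by linarith
  have hd : 0 < ξ - γ := by linarith
  -- With s = t - ξ, a correction c to W = s changes W² - W' by 2sc + c² - c'. Taking c = N/P with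
  -- N' = 2s(N + 1) cancels the growth of 2sc, leaving -2s/P and N(N + P')/P². The exponential term
  -- of P makes the latter nonpositive. The constant M is small enough that N/P ≥ ξ - γ at t = 0,
  -- and large enough that -2s/P stays below 4γ exp(-γ²). The -1 in N gives W(ξ) = 0, the value at
  -- which t - ξ takes over.
  set M : ℝ := Real.exp (ξ ^ 2) * γ / (2 * ξ * (ξ - γ)) with hM
  have hM0 : 0 < M := by positivity
  set P : ℝ → ℝ := fun t => M + Real.exp (-(t - ξ) * ξ) / ξ with hP
  set N : ℝ → ℝ := fun t => Real.exp ((t - ξ) ^ 2) - 1 with hN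
  have hP0 : ∀ t, 0 < P t := fun t => by simp only [hP]; positivity
  have hPd : ∀ t, HasDerivAt P (-Real.exp (-(t - ξ) * ξ)) t := fun t => by
    have := (((((hasDerivAt_id t).sub_const ξ).neg).mul_const ξ).exp.div_const ξ).const_add M
    refine this.congr_deriv ?_
    simp
    field_simp
  have hNd : ∀ t, HasDerivAt N (2 * (t - ξ) * Real.exp ((t - ξ) ^ 2)) t := fun t => by
    have := ((((hasDerivAt_id t).sub_const ξ).pow 2).exp.sub_const 1)
    refine this.congr_deriv ?_
    simp
    ring
  have hNc : Continuous N := by simp only [hN]; fun_prop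
  have hPc : Continuous P := by simp only [hP]; fun_prop
  refine ⟨fun t => (t - ξ) + N t / P t,
    fun t => 1 + (2 * (t - ξ) * Real.exp ((t - ξ) ^ 2) * P t
      - N t * (-Real.exp (-(t - ξ) * ξ))) / P t ^ 2, ?_, ?_, ?_, ?_, ?_⟩
  · intro t
    exact ((hasDerivAt_id t).sub_const ξ).add ((hNd t).div (hPd t) (hP0 t).ne')
  · exact continuous_const.add (((by fun_prop : Continuous _).mul hPc).sub
      (hNc.mul (by fun_prop)) |>.div (hPc.pow 2) fun t => (pow_pos (hP0 t) 2).ne')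
  · have h1 : ξ - γ ≤ N 0 / P 0 := by
      rw [le_div_iff₀ (hP0 0)]
      simp only [hP, hN, zero_sub, neg_neg, neg_sq]
      rw [← sq]
      have hexp : 2 * ξ ≤ Real.exp (ξ ^ 2) * γ := by
        have := Real.add_one_le_exp (ξ ^ 2)
        have hE := Real.exp_pos (ξ ^ 2)
        nlinarith [sq_nonneg (ξ - 1)]
      have e1 : (ξ - γ) * (M + Real.exp (ξ ^ 2) / ξ)
          = Real.exp (ξ ^ 2) - Real.exp (ξ ^ 2) * γ / (2 * ξ) := by
        rw [hM]; field_simp; ring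
      rw [e1]
      have : 1 ≤ Real.exp (ξ ^ 2) * γ / (2 * ξ) := by
        rw [le_div_iff₀ (by positivity)]; linarith
      linarith
    simp only
    linarith
  · simp [hN]
  · intro t ht
    have hs : t - ξ ≤ 0 := by linarith [ht.2]
    have hPt := hP0 t
    set s := t - ξ with hsdef
    set E := Real.exp (s ^ 2) with hE
    set Q := Real.exp (-s * ξ) with hQ
    -- This uses t ≥ 0: then 0 ≤ -s ≤ ξ, so s² ≤ -sξ.
    have hEQ : E ≤ Q := Real.exp_le_exp.2 (by nlinarith [ht.1])
    have hE1 : 1 ≤ E := Real.one_le_exp (sq_nonneg s)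
    have hNt : N t = E - 1 := rfl
    have hPM : M ≤ P t := by
      have : 0 ≤ Q / ξ := by positivity
      show M ≤ M + Q / ξ
      linarith
    have key : ((s + N t / P t) ^ 2 - (1 + (2 * s * E * P t - N t * (-Q)) / P t ^ 2))
        = s ^ 2 - 1 + N t * (N t - Q) / P t ^ 2 + 2 * (-s) / P t := by
      rw [hNt]; field_simp; ring
    rw [key]
    have k1 : N t * (N t - Q) / P t ^ 2 ≤ 0 := by
      apply div_nonpos_of_nonpos_of_nonneg _ (by positivity)
      rw [hNt]; nlinarith
    have k2 : 2 * (-s) / P t ≤ 2 * ξ / M :=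
      div_le_div₀ (by positivity) (by linarith [ht.1]) hM0 hPM
    have k3 : 2 * ξ / M ≤ 4 * γ * Real.exp (-γ ^ 2) := by
      have := sq_mul_sub_le_exp hγ hξ.le
      have e2 : Real.exp (ξ ^ 2 - γ ^ 2) = Real.exp (ξ ^ 2) * Real.exp (-γ ^ 2) := by
        rw [← Real.exp_add]; ring_nf
      rw [e2] at this
      rw [div_le_iff₀ hM0, hM]
      have e3 : 4 * γ * Real.exp (-γ ^ 2) * (Real.exp (ξ ^ 2) * γ / (2 * ξ * (ξ - γ)))
        = 2 * (γ ^ 2 * (Real.exp (ξ ^ 2) * Real.exp (-γ ^ 2))) / (ξ * (ξ - γ)) := by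
        field_simp; ring
      rw [e3, le_div_iff₀ (by positivity)]
      nlinarith
    linarith

theorem intervalIntegral_eq_setIntegral_Ioi {F : ℝ → ℝ} {B : ℝ} (hB : 0 ≤ B)
    (hF : ∀ t, B ≤ t → F t = 0) : ∫ t in (0 : ℝ)..B, F t = ∫ t in Ioi 0, F t := by
  rw [intervalIntegral.integral_of_le hB]
  refine (setIntegral_eq_of_subset_of_forall_sdiff_eq_zero measurableSet_Ioi
    Ioc_subset_Ioi_self fun t ht => hF t ?_).symm
  by_contra hlt
  exact ht.2 ⟨ht.1, (not_le.1 hlt).le⟩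

/-- Lower bound for the Robin harmonic oscillators on the half-line, uniform in the centre. -/
theorem robin_oscillator_bound {γ : ℝ} (hγ : 1 ≤ γ) (ξ : ℝ) {h h' : ℝ → ℂ} {B : ℝ}
    (hh : ∀ t, HasDerivAt h (h' t) t) (hc : Continuous h')
    (hB : ∀ t, B ≤ t → h t = 0) (hB' : ∀ t, B ≤ t → h' t = 0) :
    (1 - 4 * γ * Real.exp (-γ ^ 2)) * ∫ t in Ioi (0 : ℝ), ‖h t‖ ^ 2 ≤
      (∫ t in Ioi (0 : ℝ), (‖h' t‖ ^ 2 + (t - ξ) ^ 2 * ‖h t‖ ^ 2)) + γ * ‖h 0‖ ^ 2 := by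
  set l : ℝ := 1 - 4 * γ * Real.exp (-γ ^ 2) with hl
  have hhc : Continuous h := continuous_iff_continuousAt.2 fun t => (hh t).continuousAt
  have hl1 : l ≤ 1 := by
    have : 0 ≤ 4 * γ * Real.exp (-γ ^ 2) := by positivity
    linarith
  -- Beyond b the function vanishes, so there is no boundary term at b; b ≥ ξ leaves room for both
  -- pieces of the Riccati function.
  obtain ⟨b, hb0, hbB, hbξ⟩ : ∃ b : ℝ, 0 ≤ b ∧ B ≤ b ∧ ξ ≤ b :=
    ⟨max 0 (max B ξ), by simp, by simp, by simp⟩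
  have hhb : h b = 0 := hB b hbB
  rw [← intervalIntegral_eq_setIntegral_Ioi hb0 fun t ht => by simp [hB t (hbB.trans ht)],
    ← intervalIntegral_eq_setIntegral_Ioi hb0 fun t ht => by
      simp [hB t (hbB.trans ht), hB' t (hbB.trans ht)]]
  have split : (∫ t in (0 : ℝ)..b, (‖h' t‖ ^ 2 + (t - ξ) ^ 2 * ‖h t‖ ^ 2))
      - l * ∫ t in (0 : ℝ)..b, ‖h t‖ ^ 2
      = ∫ t in (0 : ℝ)..b, (‖h' t‖ ^ 2 + ((t - ξ) ^ 2 - l) * ‖h t‖ ^ 2) := by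
    rw [← intervalIntegral.integral_const_mul, ← intervalIntegral.integral_sub]
    · congr 1; ext t; ring
    · exact Continuous.intervalIntegrable (by fun_prop) _ _
    · exact Continuous.intervalIntegrable (by fun_prop) _ _
  suffices -γ * ‖h 0‖ ^ 2 ≤ ∫ t in (0 : ℝ)..b, (‖h' t‖ ^ 2 + ((t - ξ) ^ 2 - l) * ‖h t‖ ^ 2) by
    linarith
  have hlin : ∀ a, a ≤ b → (a - ξ) * ‖h a‖ ^ 2 ≤
      ∫ t in a..b, (‖h' t‖ ^ 2 + ((t - ξ) ^ 2 - l) * ‖h t‖ ^ 2) := fun a hab => by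
    have := picone (W := fun t => t - ξ) (W' := fun _ => 1) (V := fun t => (t - ξ) ^ 2 - l) hab hh hc
      (fun t _ => (hasDerivAt_id t).sub_const ξ) continuousOn_const (by fun_prop)
      (fun t _ => by linarith)
    simpa [hhb] using this
  -- For ξ ≤ γ the function t - ξ already starts at -ξ ≥ -γ. Otherwise the corrected function is
  -- used on [0, ξ] and t - ξ beyond; both vanish at ξ, so the two boundary terms there are zero.
  rcases le_or_gt ξ γ with hξ | hξ
  · refine le_trans ?_ (hlin 0 hb0)
    exact mul_le_mul_of_nonneg_right (by linarith) (by positivity)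
  · obtain ⟨W, W', hW, hWc, hW0, hWξ, hR⟩ := exists_riccati hγ hξ
    have hξ0 : 0 ≤ ξ := by linarith
    have h1 := picone (V := fun t => (t - ξ) ^ 2 - l) hξ0 hh hc (fun t _ => hW t) hWc.continuousOn
      (by fun_prop) hR
    have h2 := hlin ξ hbξ
    have hG : Continuous fun t => ‖h' t‖ ^ 2 + ((t - ξ) ^ 2 - l) * ‖h t‖ ^ 2 := by fun_prop
    rw [← intervalIntegral.integral_add_adjacent_intervals (hG.intervalIntegrable 0 ξ)
      (hG.intervalIntegrable ξ b)]
    have h3 := mul_le_mul_of_nonneg_right hW0 (sq_nonneg ‖h 0‖)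
    simp only [hWξ, sub_self, zero_mul, sub_zero] at h1 h2
    linarith

/-! ### Magnetic derivatives of smooth functions and Green's formulas -/

/-- First component of the magnetic gradient of a differentiable function. -/
def D₁ (φ : ℝ × ℝ → ℂ) (x : ℝ × ℝ) : ℂ := pd₁ φ x - Complex.I * (A₁ x : ℂ) * φ x

/-- Second component of the magnetic gradient of a differentiable function. -/
def D₂ (φ : ℝ × ℝ → ℂ) (x : ℝ × ℝ) : ℂ := pd₂ φ x - Complex.I * (A₂ x : ℂ) * φ x

theorem vol_eq_prod : vol = (volume : Measure ℝ).prod (volume.restrict (Ioi (0 : ℝ))) := by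
  have : halfPlane = univ ×ˢ Ioi (0 : ℝ) := by ext x; simp [halfPlane]
  rw [vol, this, Measure.volume_eq_prod, ← Measure.prod_restrict, Measure.restrict_univ]

instance : IsFiniteMeasureOnCompacts vol := by unfold vol; infer_instance

theorem isOpen_halfPlane : IsOpen halfPlane := isOpen_lt continuous_const continuous_snd

theorem continuous_A₁ : Continuous A₁ := by unfold A₁; fun_prop

theorem continuous_A₂ : Continuous A₂ := by unfold A₂; fun_prop

section Smooth

variable {φ ψ : ℝ × ℝ → ℂ}

theorem continuous_pd₁ (hφ : ContDiff ℝ 1 φ) : Continuous (pd₁ φ) :=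
  (hφ.continuous_fderiv one_ne_zero).clm_apply continuous_const

theorem continuous_pd₂ (hφ : ContDiff ℝ 1 φ) : Continuous (pd₂ φ) :=
  (hφ.continuous_fderiv one_ne_zero).clm_apply continuous_const

theorem contDiff_pd₁ (hφ : ContDiff ℝ ∞ φ) : ContDiff ℝ ∞ (pd₁ φ) :=
  (hφ.fderiv_right (m := ∞) (by simp)).clm_apply contDiff_const

theorem contDiff_pd₂ (hφ : ContDiff ℝ ∞ φ) : ContDiff ℝ ∞ (pd₂ φ) :=
  (hφ.fderiv_right (m := ∞) (by simp)).clm_apply contDiff_const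

theorem hasCompactSupport_pd₁ (hφ : HasCompactSupport φ) : HasCompactSupport (pd₁ φ) :=
  hφ.fderiv_apply ℝ _

theorem hasCompactSupport_pd₂ (hφ : HasCompactSupport φ) : HasCompactSupport (pd₂ φ) :=
  hφ.fderiv_apply ℝ _

theorem hasDerivAt_pd₁ (hφ : Differentiable ℝ φ) (x y : ℝ) :
    HasDerivAt (fun s => φ (s, y)) (pd₁ φ (x, y)) x :=
  (hφ (x, y)).hasFDerivAt.comp_hasDerivAt x ((hasDerivAt_id x).prodMk (hasDerivAt_const x y))

theorem hasDerivAt_pd₂ (hφ : Differentiable ℝ φ) (x y : ℝ) :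
    HasDerivAt (fun s => φ (x, s)) (pd₂ φ (x, y)) y :=
  (hφ (x, y)).hasFDerivAt.comp_hasDerivAt y ((hasDerivAt_const y x).prodMk (hasDerivAt_id y))

theorem isClosedEmbedding_mk_left (x : ℝ) : Topology.IsClosedEmbedding fun y : ℝ => (x, y) :=
  Topology.IsClosedEmbedding.of_continuous_injective_isClosedMap (by fun_prop)
    (fun _ _ h => (Prod.mk.inj h).2)
    fun s hs => by
      have : (fun y : ℝ => (x, y)) '' s = {x} ×ˢ s := by ext ⟨a, b⟩; aesop
      rw [this]; exact isClosed_singleton.prod hs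

theorem isClosedEmbedding_mk_right (y : ℝ) : Topology.IsClosedEmbedding fun x : ℝ => (x, y) :=
  Topology.IsClosedEmbedding.of_continuous_injective_isClosedMap (by fun_prop)
    (fun _ _ h => (Prod.mk.inj h).1)
    fun s hs => by
      have : (fun x : ℝ => (x, y)) '' s = s ×ˢ {y} := by ext ⟨a, b⟩; aesop
      rw [this]; exact hs.prod isClosed_singleton

theorem hasCompactSupport_slice_left (hφ : HasCompactSupport φ) (x : ℝ) :
    HasCompactSupport fun y => φ (x, y) :=
  hφ.comp_isClosedEmbedding (isClosedEmbedding_mk_left x)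

theorem hasCompactSupport_slice_right (hφ : HasCompactSupport φ) (y : ℝ) :
    HasCompactSupport fun x => φ (x, y) :=
  hφ.comp_isClosedEmbedding (isClosedEmbedding_mk_right y)

theorem integral_pd₁ (hφ : ContDiff ℝ 1 φ) (hs : HasCompactSupport φ) :
    ∫ x, pd₁ φ x ∂vol = 0 := by
  have hi : Integrable (pd₁ φ) vol :=
    (continuous_pd₁ hφ).integrable_of_hasCompactSupport (hasCompactSupport_pd₁ hs)
  rw [vol_eq_prod] at hi ⊢
  rw [integral_prod_symm _ hi]
  have : ∀ y : ℝ, ∫ x, pd₁ φ (x, y) = 0 := fun y =>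
    integral_eq_zero_of_hasDerivAt_of_integrable
      (fun x => hasDerivAt_pd₁ (hφ.differentiable one_ne_zero) x y)
      (((continuous_pd₁ hφ).comp (by fun_prop)).integrable_of_hasCompactSupport
        (hasCompactSupport_slice_right (hasCompactSupport_pd₁ hs) y))
      ((hφ.continuous.comp (by fun_prop)).integrable_of_hasCompactSupport
        (hasCompactSupport_slice_right hs y))
  simp [this]

theorem integral_pd₂ (hφ : ContDiff ℝ 1 φ) (hs : HasCompactSupport φ) :
    ∫ x, pd₂ φ x ∂vol = -∫ s : ℝ, φ (s, 0) := by
  have hi : Integrable (pd₂ φ) vol :=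
    (continuous_pd₂ hφ).integrable_of_hasCompactSupport (hasCompactSupport_pd₂ hs)
  rw [vol_eq_prod] at hi ⊢
  rw [integral_prod _ hi, ← integral_neg]
  congr 1
  ext x
  have hc := hasCompactSupport_slice_left hs x
  have := integral_Ioi_of_hasDerivAt_of_tendsto' (a := (0 : ℝ)) (m := (0 : ℂ))
    (fun y _ => hasDerivAt_pd₂ (hφ.differentiable one_ne_zero) x y)
    (((continuous_pd₂ hφ).comp (by fun_prop : Continuous fun y : ℝ => (x, y))
      ).integrable_of_hasCompactSupport
        (hasCompactSupport_slice_left (hasCompactSupport_pd₂ hs) x)).integrableOn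
    (hc.is_zero_at_infty.mono_left (atTop_le_cocompact))
  simpa using this

theorem pd₁_mul (hφ : Differentiable ℝ φ) (hψ : Differentiable ℝ ψ) (x : ℝ × ℝ) :
    pd₁ (fun y => φ y * ψ y) x = pd₁ φ x * ψ x + φ x * pd₁ ψ x := by
  simp only [pd₁, fderiv_fun_mul (hφ x) (hψ x)]
  simp; ring

theorem pd₂_mul (hφ : Differentiable ℝ φ) (hψ : Differentiable ℝ ψ) (x : ℝ × ℝ) :
    pd₂ (fun y => φ y * ψ y) x = pd₂ φ x * ψ x + φ x * pd₂ ψ x := by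
  simp only [pd₂, fderiv_fun_mul (hφ x) (hψ x)]
  simp; ring

theorem continuous_D₁ (hφ : ContDiff ℝ 1 φ) : Continuous (D₁ φ) := by
  have := continuous_pd₁ hφ
  have := hφ.continuous
  have := continuous_A₁
  unfold D₁
  fun_prop

theorem continuous_D₂ (hφ : ContDiff ℝ 1 φ) : Continuous (D₂ φ) := by
  have := continuous_pd₂ hφ
  have := hφ.continuous
  have := continuous_A₂
  unfold D₂
  fun_prop

theorem hasCompactSupport_D₁ (hφ : HasCompactSupport φ) : HasCompactSupport (D₁ φ) :=
  (hasCompactSupport_pd₁ hφ).sub hφ.mul_left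

theorem hasCompactSupport_D₂ (hφ : HasCompactSupport φ) : HasCompactSupport (D₂ φ) :=
  (hasCompactSupport_pd₂ hφ).sub hφ.mul_left

/-- The pairing is bilinear, without conjugation, so the transpose of ∂ - iA is -(∂ + iA): the
potential terms cancel and a total derivative remains. -/
theorem green₁ (hφ : ContDiff ℝ 1 φ) (hψ : ContDiff ℝ 1 ψ) (hs : HasCompactSupport ψ) :
    ∫ x, D₁ φ x * ψ x ∂vol =
      -∫ x, φ x * (pd₁ ψ x + Complex.I * (A₁ x : ℂ) * ψ x) ∂vol := by
  have hA := continuous_A₁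
  have hφc := hφ.continuous
  have hψc := hψ.continuous
  have hp := continuous_pd₁ hψ
  have h1 : Integrable (fun x => D₁ φ x * ψ x) vol :=
    ((continuous_D₁ hφ).mul hψ.continuous).integrable_of_hasCompactSupport hs.mul_left
  have h2 : Integrable (fun x => φ x * (pd₁ ψ x + Complex.I * (A₁ x : ℂ) * ψ x)) vol :=
    Continuous.integrable_of_hasCompactSupport (by fun_prop)
      ((hasCompactSupport_pd₁ hs).add hs.mul_left).mul_left
  have h3 := integral_pd₁ (hφ.mul hψ) hs.mul_left
  rw [eq_neg_iff_add_eq_zero, ← integral_add h1 h2, ← h3]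
  congr 1
  ext x
  rw [pd₁_mul (hφ.differentiable one_ne_zero) (hψ.differentiable one_ne_zero), D₁]
  ring

theorem green₂ (hφ : ContDiff ℝ 1 φ) (hψ : ContDiff ℝ 1 ψ) (hs : HasCompactSupport ψ) :
    ∫ x, D₂ φ x * ψ x ∂vol =
      -(∫ x, φ x * (pd₂ ψ x + Complex.I * (A₂ x : ℂ) * ψ x) ∂vol)
        - ∫ s : ℝ, φ (s, 0) * ψ (s, 0) := by
  have hA := continuous_A₂
  have hφc := hφ.continuous
  have hψc := hψ.continuous
  have hp := continuous_pd₂ hψ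
  have h1 : Integrable (fun x => D₂ φ x * ψ x) vol :=
    ((continuous_D₂ hφ).mul hψ.continuous).integrable_of_hasCompactSupport hs.mul_left
  have h2 : Integrable (fun x => φ x * (pd₂ ψ x + Complex.I * (A₂ x : ℂ) * ψ x)) vol :=
    Continuous.integrable_of_hasCompactSupport (by fun_prop)
      ((hasCompactSupport_pd₂ hs).add hs.mul_left).mul_left
  have h3 := integral_pd₂ (hφ.mul hψ) hs.mul_left
  rw [sub_eq_neg_add, ← h3, eq_add_neg_iff_add_eq, ← integral_add h1 h2]
  congr 1
  ext x
  rw [pd₂_mul (hφ.differentiable one_ne_zero) (hψ.differentiable one_ne_zero), D₂]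
  ring

theorem memMagneticH1_of_contDiff (hφ : ContDiff ℝ 1 φ) (h : MemLp φ 2 vol)
    (h₁ : MemLp (D₁ φ) 2 vol) (h₂ : MemLp (D₂ φ) 2 vol) : MemMagneticH1 φ (D₁ φ) (D₂ φ) where
  memLp := h
  memLp₁ := h₁
  memLp₂ := h₂
  isMagneticGradient ψ hψ hs ht := by
    have hψ1 : ContDiff ℝ 1 ψ := hψ.of_le (by exact_mod_cast le_top)
    refine ⟨green₁ hφ hψ1 hs, ?_⟩
    rw [green₂ hφ hψ1 hs]
    have : ∀ s : ℝ, ψ (s, 0) = 0 := fun s => by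
      by_contra hne
      exact lt_irrefl (0 : ℝ) (ht (subset_tsupport ψ hne))
    simp [this]

theorem isTrace_of_contDiff (hφ : ContDiff ℝ 1 φ) (h : MemLp (fun s : ℝ => φ (s, 0)) 2 volume) :
    IsTrace φ (D₂ φ) fun s => φ (s, 0) where
  memLp := h
  green _ hψ hs := green₂ hφ (hψ.of_le (by exact_mod_cast le_top)) hs

end Smooth

/-! ### Tangential Fourier transform and the lower bound for test functions -/

open scoped FourierTransform

/-- The partial Fourier transform in the tangential variable `x₁`. -/
def tangentialFourier (w : ℝ × ℝ → ℂ) (k t : ℝ) : ℂ := 𝓕 (fun x : ℝ => w (x, t)) k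

section

variable {w : ℝ × ℝ → ℂ}

theorem tangentialFourier_eq (w : ℝ × ℝ → ℂ) (k t : ℝ) : tangentialFourier w k t =
    ∫ x : ℝ, Complex.exp (↑(-2 * Real.pi * x * k) * Complex.I) * w (x, t) := by
  rw [tangentialFourier, Real.fourier_real_eq_integral_exp_smul]
  rfl

theorem norm_exp_ofReal_mul_I_mul (r : ℝ) (z : ℂ) :
    ‖Complex.exp (r * Complex.I) * z‖ = ‖z‖ := by
  rw [norm_mul, Complex.norm_exp_ofReal_mul_I, one_mul]

theorem plancherel_slice (hw : ContDiff ℝ ∞ w) (hs : HasCompactSupport w) (t : ℝ) :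
    Integrable (fun k => ‖tangentialFourier w k t‖ ^ 2) ∧
      ∫ k : ℝ, ‖tangentialFourier w k t‖ ^ 2 = ∫ x : ℝ, ‖w (x, t)‖ ^ 2 := by
  set S := (hasCompactSupport_slice_right hs t).toSchwartzMap
    (hw.comp (by fun_prop : ContDiff ℝ ∞ fun x : ℝ => (x, t))) with hS
  have hF : ∀ k, tangentialFourier w k t = (𝓕 S) k := fun k => by
    rw [SchwartzMap.fourier_coe]; rfl
  simp only [hF]
  exact ⟨((𝓕 S).memLp 2).integrable_norm_pow (by norm_num), S.integral_norm_sq_fourier⟩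

/-- The bound is uniform in t, which provides the dominating function for differentiating the
Fourier integral in the normal variable. -/
theorem exists_bound_integrable (hw : Continuous w) (hs : HasCompactSupport w) :
    ∃ b : ℝ → ℝ, Integrable b ∧ ∀ x t, ‖w (x, t)‖ ≤ b x := by
  obtain ⟨C, hC⟩ := hs.exists_bound_of_continuous hw
  have hK : IsCompact (Prod.fst '' tsupport w) := hs.isCompact.image continuous_fst
  refine ⟨(Prod.fst '' tsupport w).indicator fun _ => C,
    (integrable_indicator_iff hK.measurableSet).2 (integrableOn_const hK.measure_lt_top.ne),
    fun x t => ?_⟩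
  by_cases hx : x ∈ Prod.fst '' tsupport w
  · rw [indicator_of_mem hx]; exact hC _
  · have h0 : w (x, t) = 0 := image_eq_zero_of_notMem_tsupport fun h => hx ⟨_, h, rfl⟩
    rw [indicator_of_notMem hx, h0, norm_zero]

theorem hasDerivAt_tangentialFourier (hw : ContDiff ℝ ∞ w) (hs : HasCompactSupport w) (k t : ℝ) :
    HasDerivAt (tangentialFourier w k) (tangentialFourier (pd₂ w) k t) t := by
  have hw1 : ContDiff ℝ 1 w := hw.of_le (by exact_mod_cast le_top)
  have hwc := hw.continuous
  have hpc := continuous_pd₂ hw1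
  obtain ⟨b, hb, hbb⟩ := exists_bound_integrable hpc (hasCompactSupport_pd₂ hs)
  have hE : Continuous fun x : ℝ => Complex.exp (↑(-2 * Real.pi * x * k) * Complex.I) := by fun_prop
  have h := hasDerivAt_integral_of_dominated_loc_of_deriv_le (μ := volume) (x₀ := t) (s := univ)
    (bound := b)
    (F := fun t x => Complex.exp (↑(-2 * Real.pi * x * k) * Complex.I) * w (x, t))
    (F' := fun t x => Complex.exp (↑(-2 * Real.pi * x * k) * Complex.I) * pd₂ w (x, t))
    Filter.univ_mem
    (Filter.Eventually.of_forall fun s => (by fun_prop : Continuous _).aestronglyMeasurable)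
    ((by fun_prop : Continuous _).integrable_of_hasCompactSupport
      (hasCompactSupport_slice_right hs t).mul_left)
    (by fun_prop : Continuous _).aestronglyMeasurable
    (Filter.Eventually.of_forall fun x s _ => by
      rw [norm_exp_ofReal_mul_I_mul]; exact hbb x s) hb
    (Filter.Eventually.of_forall fun x s _ =>
      (hasDerivAt_pd₂ (hw1.differentiable one_ne_zero) x s).const_mul _)
  rw [tangentialFourier_eq]
  simpa only [funext (tangentialFourier_eq w k)] using h.2

theorem continuous_tangentialFourier (hw : ContDiff ℝ ∞ w) (hs : HasCompactSupport w) (k : ℝ) :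
    Continuous (tangentialFourier w k) :=
  continuous_iff_continuousAt.2 fun t => (hasDerivAt_tangentialFourier hw hs k t).continuousAt

theorem stronglyMeasurable_tangentialFourier (hw : Continuous w) :
    StronglyMeasurable fun p : ℝ × ℝ => tangentialFourier w p.1 p.2 := by
  simp only [tangentialFourier_eq]
  exact (by fun_prop : Continuous fun q : (ℝ × ℝ) × ℝ =>
    Complex.exp (↑(-2 * Real.pi * q.2 * q.1.1) * Complex.I) * w (q.2, q.1.2)
    ).stronglyMeasurable.integral_prod_right

theorem tangentialFourier_pd₁ (hw : ContDiff ℝ ∞ w) (hs : HasCompactSupport w) (k t : ℝ) :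
    tangentialFourier (pd₁ w) k t = 2 * Real.pi * Complex.I * k * tangentialFourier w k t := by
  have hw1 : ContDiff ℝ 1 w := hw.of_le (by exact_mod_cast le_top)
  have hd : deriv (fun x => w (x, t)) = fun x => pd₁ w (x, t) := funext fun x =>
    (hasDerivAt_pd₁ (hw1.differentiable one_ne_zero) x t).deriv
  have hwc := hw.continuous
  have hpc := continuous_pd₁ hw1
  have := Real.fourier_deriv (f := fun x => w (x, t))
    ((by fun_prop : Continuous _).integrable_of_hasCompactSupport
      (hasCompactSupport_slice_right hs t))
    (fun x => (hasDerivAt_pd₁ (hw1.differentiable one_ne_zero) x t).differentiableAt)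
    (by rw [hd]
        exact (by fun_prop : Continuous _).integrable_of_hasCompactSupport
          (hasCompactSupport_slice_right (hasCompactSupport_pd₁ hs) t))
  rw [hd] at this
  exact congrFun this k

theorem integrable_norm_sq_of_contDiff (hw : ContDiff ℝ ∞ w) (hs : HasCompactSupport w) :
    Integrable (fun x => ‖w x‖ ^ 2) vol := by
  have hc := hw.continuous
  simp only [sq]
  exact (by fun_prop : Continuous _).integrable_of_hasCompactSupport hs.norm.mul_left

theorem plancherel_halfPlane (hw : ContDiff ℝ ∞ w) (hs : HasCompactSupport w) :
    Integrable (fun p : ℝ × ℝ => ‖tangentialFourier w p.1 p.2‖ ^ 2) vol ∧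
      ∫ p, ‖tangentialFourier w p.1 p.2‖ ^ 2 ∂vol = ∫ x, ‖w x‖ ^ 2 ∂vol := by
  have hwi := integrable_norm_sq_of_contDiff hw hs
  have hm : AEStronglyMeasurable (fun p : ℝ × ℝ => ‖tangentialFourier w p.1 p.2‖ ^ 2) vol :=
    ((stronglyMeasurable_tangentialFourier hw.continuous).norm.pow 2).aestronglyMeasurable
  rw [vol_eq_prod] at hwi hm ⊢
  have hi : Integrable (fun p : ℝ × ℝ => ‖tangentialFourier w p.1 p.2‖ ^ 2)
      ((volume : Measure ℝ).prod (volume.restrict (Ioi (0 : ℝ)))) := by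
    rw [integrable_prod_iff' hm]
    refine ⟨Filter.Eventually.of_forall fun t => (plancherel_slice hw hs t).1, ?_⟩
    simpa only [norm_pow, norm_norm, (plancherel_slice hw hs _).2] using
      hwi.integral_prod_right
  refine ⟨hi, ?_⟩
  rw [integral_prod_symm _ hi, integral_prod_symm _ hwi]
  simp only [(plancherel_slice hw hs _).2]

theorem exists_tangentialFourier_eq_zero (hs : HasCompactSupport w) :
    ∃ B : ℝ, ∀ k t, B ≤ t → tangentialFourier w k t = 0 := by
  obtain ⟨B, hB⟩ := (hs.isCompact.image continuous_snd).bddAbove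
  -- The shift by 1 places the line strictly above the support.
  refine ⟨B + 1, fun k t ht => ?_⟩
  have : ∀ x, w (x, t) = 0 := fun x => by
    by_contra hne
    have := hB ⟨_, subset_tsupport w hne, rfl⟩
    simp only at this
    linarith
  simp [tangentialFourier_eq, this]

/-- The tangential derivative becomes multiplication by 2πik, so ∂₁ + i x₂ becomes i(t + 2πk): an
oscillator potential centred at -2πk. -/
theorem norm_sq_tangentialFourier_landau (hw : ContDiff ℝ ∞ w) (hs : HasCompactSupport w)
    (k t : ℝ) : ‖tangentialFourier (fun x => pd₁ w x + Complex.I * x.2 * w x) k t‖ ^ 2 =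
      (t - (-(2 * Real.pi * k))) ^ 2 * ‖tangentialFourier w k t‖ ^ 2 := by
  set z : ℝ × ℝ → ℂ := fun x => pd₁ w x + Complex.I * x.2 * w x with hz
  have hwc := hw.continuous
  have hpc := (contDiff_pd₁ hw).continuous
  have h1 : tangentialFourier z k t = tangentialFourier (pd₁ w) k t
      + Complex.I * t * tangentialFourier w k t := by
    simp only [tangentialFourier_eq, hz]
    rw [← integral_const_mul, ← integral_add]
    · congr 1; ext x; ring
    · exact (by fun_prop : Continuous _).integrable_of_hasCompactSupport
        (hasCompactSupport_slice_right (hasCompactSupport_pd₁ hs) t).mul_left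
    · exact (by fun_prop : Continuous _).integrable_of_hasCompactSupport
        (hasCompactSupport_slice_right hs t).mul_left.mul_left
  have h2 : tangentialFourier z k t =
      Complex.I * ((t - (-(2 * Real.pi * k)) : ℝ) : ℂ) * tangentialFourier w k t := by
    rw [h1, tangentialFourier_pd₁ hw hs]; push_cast; ring
  rw [h2, norm_mul, norm_mul, mul_pow, mul_pow, Complex.norm_I, Complex.norm_real,
    Real.norm_eq_abs, sq_abs]
  ring

/-- The lower bound in the Landau gauge. -/
theorem landau_bound {γ : ℝ} (hγ : 1 ≤ γ) (hw : ContDiff ℝ ∞ w) (hs : HasCompactSupport w) :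
    (1 - 4 * γ * Real.exp (-γ ^ 2)) * ∫ x, ‖w x‖ ^ 2 ∂vol ≤
      (∫ x, (‖pd₂ w x‖ ^ 2 + ‖pd₁ w x + Complex.I * x.2 * w x‖ ^ 2) ∂vol)
        + γ * ∫ s : ℝ, ‖w (s, 0)‖ ^ 2 := by
  set z : ℝ × ℝ → ℂ := fun x => pd₁ w x + Complex.I * x.2 * w x with hz
  have hx2 : ContDiff ℝ ∞ fun x : ℝ × ℝ => Complex.I * (x.2 : ℂ) :=
    contDiff_const.mul (Complex.ofRealCLM.contDiff.comp contDiff_snd)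
  have hzd : ContDiff ℝ ∞ z := (contDiff_pd₁ hw).add (hx2.mul hw)
  have hzs : HasCompactSupport z := (hasCompactSupport_pd₁ hs).add hs.mul_left
  have hyd := contDiff_pd₂ hw
  have hys := hasCompactSupport_pd₂ hs
  have hFz := norm_sq_tangentialFourier_landau hw hs
  rw [← hz] at hFz
  obtain ⟨iw, ew⟩ := plancherel_halfPlane hw hs
  obtain ⟨iz, ez⟩ := plancherel_halfPlane hzd hzs
  obtain ⟨iy, ey⟩ := plancherel_halfPlane hyd hys
  obtain ⟨i0, e0⟩ := plancherel_slice hw hs 0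
  rw [integral_add (integrable_norm_sq_of_contDiff hyd hys)
    (integrable_norm_sq_of_contDiff hzd hzs), ← ew, ← ez, ← ey, ← e0, ← integral_add iy iz]
  have iyz : Integrable (fun p : ℝ × ℝ => ‖tangentialFourier (pd₂ w) p.1 p.2‖ ^ 2
    + ‖tangentialFourier z p.1 p.2‖ ^ 2) vol := iy.add iz
  rw [vol_eq_prod] at iw iyz ⊢
  rw [integral_prod _ iw, integral_prod _ iyz, ← integral_const_mul, ← integral_const_mul,
    ← integral_add iyz.integral_prod_left (i0.const_mul γ)]
  refine integral_mono (iw.integral_prod_left.const_mul _)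
    (iyz.integral_prod_left.add (i0.const_mul γ)) fun k => ?_
  obtain ⟨B, hB⟩ := exists_tangentialFourier_eq_zero hs
  obtain ⟨B', hB'⟩ := exists_tangentialFourier_eq_zero hys
  have := robin_oscillator_bound hγ (-(2 * Real.pi * k)) (B := max B B')
    (hasDerivAt_tangentialFourier hw hs k) (continuous_tangentialFourier hyd hys k)
    (fun t ht => hB k t (le_trans (le_max_left _ _) ht))
    (fun t ht => hB' k t (le_trans (le_max_right _ _) ht))
  simpa only [Pi.add_apply, hFz] using this

/-- The lower bound in the symmetric gauge, for test functions. -/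
theorem magnetic_bound_of_contDiff {φ : ℝ × ℝ → ℂ} {γ : ℝ} (hγ : 1 ≤ γ) (hφ : ContDiff ℝ ∞ φ)
    (hs : HasCompactSupport φ) :
    (1 - 4 * γ * Real.exp (-γ ^ 2)) * ∫ x, ‖φ x‖ ^ 2 ∂vol ≤
      (∫ x, (‖D₁ φ x‖ ^ 2 + ‖D₂ φ x‖ ^ 2) ∂vol) + γ * ∫ s : ℝ, ‖φ (s, 0)‖ ^ 2 := by
  -- Multiplication by this phase takes the symmetric potential to the Landau potential (-x₂, 0) and
  -- preserves all pointwise norms.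
  set e : ℝ × ℝ → ℂ := fun x => Complex.exp (((-(x.1 * x.2 / 2) : ℝ) : ℂ) * Complex.I) with he
  have hθ : ContDiff ℝ ∞ fun x : ℝ × ℝ => -(x.1 * x.2 / 2) := by fun_prop
  have hed : ContDiff ℝ ∞ e :=
    ((Complex.ofRealCLM.contDiff.comp hθ).mul contDiff_const).cexp
  have hediff := hed.differentiable (by simp)
  have hφdiff := hφ.differentiable (by simp)
  have he1 : ∀ x, pd₁ e x = -(Complex.I * (x.2 / 2)) * e x := fun x => by
    have h1 := hasDerivAt_pd₁ hediff x.1 x.2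
    have h2 := ((((((hasDerivAt_id x.1).mul_const x.2).div_const 2).neg).ofReal_comp).mul_const
      Complex.I).cexp
    rw [h1.unique h2]
    simp [he]; ring
  have he2 : ∀ x, pd₂ e x = -(Complex.I * (x.1 / 2)) * e x := fun x => by
    have h1 := hasDerivAt_pd₂ hediff x.1 x.2
    have h2 := ((((((hasDerivAt_id x.2).const_mul x.1).div_const 2).neg).ofReal_comp).mul_const
      Complex.I).cexp
    rw [h1.unique h2]
    simp [he]; ring
  have key := landau_bound hγ (hed.mul hφ) hs.mul_left
  have n0 : ∀ x, ‖e x * φ x‖ = ‖φ x‖ := fun x => norm_exp_ofReal_mul_I_mul _ _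
  have n1 : ∀ x : ℝ × ℝ, ‖pd₁ (fun y => e y * φ y) x + Complex.I * x.2 * (e x * φ x)‖ = ‖D₁ φ x‖ :=
    fun x => by
      rw [← norm_exp_ofReal_mul_I_mul (-(x.1 * x.2 / 2)) (D₁ φ x), pd₁_mul hediff hφdiff, he1,
        D₁, A₁]
      congr 1
      simp only [he]
      push_cast
      ring
  have n2 : ∀ x : ℝ × ℝ, ‖pd₂ (fun y => e y * φ y) x‖ = ‖D₂ φ x‖ :=
    fun x => by
      rw [← norm_exp_ofReal_mul_I_mul (-(x.1 * x.2 / 2)) (D₂ φ x), pd₂_mul hediff hφdiff, he2,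
        D₂, A₂]
      congr 1
      simp only [he]
      push_cast
      ring
  simp only [n0, n1, n2] at key
  simpa only [add_comm] using key

end

/-! ### Continuity of translations in L² and averages of translates -/

open scoped ENNReal Convolution Topology

theorem sq_eLpNorm_two {α : Type*} [MeasurableSpace α] (μ : Measure α) (f : α → ℂ) :
    eLpNorm f 2 μ ^ 2 = ∫⁻ x, ‖f x‖ₑ ^ 2 ∂μ := by
  have := eLpNorm_nnreal_pow_eq_lintegral (μ := μ) (f := f) (p := 2) (by norm_num)
  simpa only [NNReal.coe_ofNat, ENNReal.rpow_ofNat, ENNReal.coe_ofNat] using this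

theorem sq_lintegral_le {α : Type*} [MeasurableSpace α] (Q : Measure α) [IsProbabilityMeasure Q]
    {g : α → ℝ≥0∞} (hg : AEMeasurable g Q) : (∫⁻ z, g z ∂Q) ^ 2 ≤ ∫⁻ z, g z ^ 2 ∂Q := by
  have := ENNReal.lintegral_mul_le_Lp_mul_Lq Q Real.HolderConjugate.two_two
    (f := fun _ => 1) (g := g) aemeasurable_const hg
  simp only [Pi.mul_apply, one_mul, ENNReal.one_rpow, lintegral_const, measure_univ, mul_one,
    ENNReal.rpow_ofNat, one_pow] at this
  calc (∫⁻ z, g z ∂Q) ^ 2 ≤ ((∫⁻ z, g z ^ 2 ∂Q) ^ (1 / 2 : ℝ)) ^ 2 := by gcongr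
    _ = _ := by
      rw [← ENNReal.rpow_ofNat, ← ENNReal.rpow_mul]; norm_num

/-- Translations preserve Lebesgue measure, and composition with a continuous family of
measure-preserving maps is continuous in L². -/
theorem tendsto_eLpNorm_translate {f : ℝ × ℝ → ℂ} (hf : MemLp f 2 volume) :
    Filter.Tendsto (fun z : ℝ × ℝ => eLpNorm (fun x => f (x - z) - f x) 2 volume) (𝓝 0) (𝓝 0) := by
  have hmp : ∀ z : ℝ × ℝ, MeasurePreserving (fun x : ℝ × ℝ => x - z) volume volume :=
    fun z => measurePreserving_sub_right volume z
  let g : C(ℝ × ℝ, C(ℝ × ℝ, ℝ × ℝ)) :=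
    (ContinuousMap.mk (fun p : (ℝ × ℝ) × (ℝ × ℝ) => p.2 - p.1) (by fun_prop)).curry
  have hc : Continuous fun z => Lp.compMeasurePreserving (g z) (hmp z) (hf.toLp f) :=
    continuous_const.compMeasurePreservingLp g.continuous hmp (by norm_num)
  have ht := (tendsto_iff_edist_tendsto_0.1 (hc.tendsto 0))
  refine ht.congr fun z => ?_
  have e : ∀ z, Lp.compMeasurePreserving (g z) (hmp z) (hf.toLp f) =
      (hf.comp_measurePreserving (hmp z)).toLp _ := fun z => by
    exact Lp.toLp_compMeasurePreserving hf (hmp z)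
  rw [e, e, Lp.edist_toLp_toLp]
  congr 1
  ext x
  simp

/-- Averaging translates against a probability density stays close in `L²`. -/
theorem eLpNorm_average_sub_le {f : ℝ × ℝ → ℂ} (hf : MemLp f 2 volume) {ρ : ℝ × ℝ → ℝ}
    (hρ : Continuous ρ) (hs : HasCompactSupport ρ) (h0 : ∀ z, 0 ≤ ρ z) (h1 : ∫ z, ρ z = 1)
    {ε : ℝ≥0∞} (hε : ∀ z ∈ tsupport ρ, eLpNorm (fun x => f (x - z) - f x) 2 volume ≤ ε) :
    eLpNorm (fun x => (∫ z, f (x - z) * (ρ z : ℂ)) - f x) 2 volume ≤ ε := by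
  -- For the probability measure ρ dz, the square of a mean is at most the mean of the squares;
  -- exchanging the integrals then leaves the L² distances between f and its translates.
  set Q : Measure (ℝ × ℝ) := volume.withDensity fun z => ENNReal.ofReal (ρ z) with hQ
  have hρm : Measurable fun z => ENNReal.ofReal (ρ z) := hρ.measurable.ennreal_ofReal
  have hρi : Integrable ρ := hρ.integrable_of_hasCompactSupport hs
  have : IsProbabilityMeasure Q := ⟨by
    rw [hQ, withDensity_apply _ MeasurableSet.univ, Measure.restrict_univ,
      ← ofReal_integral_eq_lintegral_ofReal hρi (Filter.Eventually.of_forall h0), h1,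
      ENNReal.ofReal_one]⟩
  have hQac : Q ≪ volume := withDensity_absolutelyContinuous _ _
  have hloc : LocallyIntegrable f := hf.locallyIntegrable (by norm_num)
  have hmeas : ∀ x, AEStronglyMeasurable (fun z => f (x - z) - f x) volume := fun x =>
    (hf.1.comp_measurePreserving (Measure.measurePreserving_sub_left volume x)).sub
      aestronglyMeasurable_const
  have hpt : ∀ x, ‖(∫ z, f (x - z) * (ρ z : ℂ)) - f x‖ₑ ^ 2 ≤
      ∫⁻ z, ‖f (x - z) - f x‖ₑ ^ 2 ∂Q := fun x => by
    have hρc : Continuous fun z => (ρ z : ℂ) := by fun_prop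
    have hρs : HasCompactSupport fun z => (ρ z : ℂ) := hs.comp_left Complex.ofReal_zero
    have hi : Integrable fun z => f (x - z) * (ρ z : ℂ) :=
      ((hρs.convolutionExists_right (ContinuousLinearMap.mul ℝ ℂ) hloc hρc) x).integrable_swap
    have hi2 : Integrable fun z => f x * (ρ z : ℂ) := (hρc.integrable_of_hasCompactSupport hρs).const_mul _
    have e1 : (∫ z, f (x - z) * (ρ z : ℂ)) - f x = ∫ z, (f (x - z) - f x) * (ρ z : ℂ) := by
      have : f x = ∫ z, f x * (ρ z : ℂ) := by
        rw [integral_const_mul, integral_complex_ofReal, h1]; simp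
      simp only [sub_mul]
      rw [integral_sub hi hi2, ← this]
    have e2 : ‖(∫ z, f (x - z) * (ρ z : ℂ)) - f x‖ₑ ≤ ∫⁻ z, ‖f (x - z) - f x‖ₑ ∂Q := by
      rw [e1, hQ, lintegral_withDensity_eq_lintegral_mul₀ hρm.aemeasurable (hmeas x).enorm]
      refine (enorm_integral_le_lintegral_enorm _).trans (lintegral_mono fun z => ?_)
      rw [Pi.mul_apply, enorm_mul, mul_comm]
      gcongr
      rw [← ofReal_norm, Complex.norm_real, Real.norm_of_nonneg (h0 z)]
    calc _ ≤ (∫⁻ z, ‖f (x - z) - f x‖ₑ ∂Q) ^ 2 := by gcongr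
      _ ≤ _ := sq_lintegral_le Q ((hmeas x).mono_ac hQac).enorm
  have hjoint : AEMeasurable (Function.uncurry fun x z => ‖f (x - z) - f x‖ₑ ^ 2)
      ((volume : Measure (ℝ × ℝ)).prod Q) := by
    have a1 : AEStronglyMeasurable (fun p : (ℝ × ℝ) × (ℝ × ℝ) => f (p.1 - p.2)) (volume.prod Q) :=
      hf.1.comp_quasiMeasurePreserving (quasiMeasurePreserving_sub_of_right_invariant volume Q)
    have a2 : AEStronglyMeasurable (fun p : (ℝ × ℝ) × (ℝ × ℝ) => f p.1) (volume.prod Q) :=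
      hf.1.comp_fst
    exact (a1.sub a2).enorm.pow_const 2
  have hsq : eLpNorm (fun x => (∫ z, f (x - z) * (ρ z : ℂ)) - f x) 2 volume ^ 2 ≤ ε ^ 2 := by
    rw [sq_eLpNorm_two]
    calc _ ≤ ∫⁻ x, ∫⁻ z, ‖f (x - z) - f x‖ₑ ^ 2 ∂Q := lintegral_mono hpt
      _ = ∫⁻ z, (∫⁻ x, ‖f (x - z) - f x‖ₑ ^ 2) ∂Q := lintegral_lintegral_swap hjoint
      _ ≤ ∫⁻ _, ε ^ 2 ∂Q := by
        rw [hQ, lintegral_withDensity_eq_lintegral_mul_non_measurable _ hρm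
          (Filter.Eventually.of_forall fun z => ENNReal.ofReal_lt_top),
          lintegral_withDensity_eq_lintegral_mul_non_measurable _ hρm
          (Filter.Eventually.of_forall fun z => ENNReal.ofReal_lt_top)]
        refine lintegral_mono fun z => ?_
        by_cases hz : z ∈ tsupport ρ
        · simp only [Pi.mul_apply]
          gcongr
          rw [← sq_eLpNorm_two]
          gcongr
          exact hε z hz
        · simp [image_eq_zero_of_notMem_tsupport hz]
      _ = ε ^ 2 := by simp
  exact (ENNReal.pow_le_pow_left_iff two_ne_zero).1 hsq

/-! ### One-sided mollification and approximation up to the boundary -/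

section Mollification

variable {f f' u v χ ψ ρ : ℝ × ℝ → ℂ} {e : ℝ × ℝ} {a : ℝ × ℝ → ℝ}

theorem integrable_mul_of_hasCompactSupport (hf : MemLp f 2 vol) (hψ : Continuous ψ)
    (hs : HasCompactSupport ψ) : Integrable (fun x => f x * ψ x) vol :=
  MemLp.integrable_mul (p := 2) (q := 2) hf (hψ.memLp_of_hasCompactSupport hs)

theorem memLp_mul_of_hasCompactSupport (hf : MemLp f 2 vol) (hψ : Continuous ψ)
    (hs : HasCompactSupport ψ) : MemLp (fun x => ψ x * f x) 2 vol := by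
  obtain ⟨C, hC⟩ := hs.exists_bound_of_continuous hψ
  refine MemLp.of_le_mul (c := C) hf (hψ.aestronglyMeasurable.mul hf.1)
    (Filter.Eventually.of_forall fun x => ?_)
  rw [norm_mul]
  exact mul_le_mul_of_nonneg_right (hC x) (norm_nonneg _)

theorem continuous_fderiv_test (hψ : ContDiff ℝ ∞ ψ) : Continuous fun x => fderiv ℝ ψ x e :=
  (hψ.continuous_fderiv (by simp)).clm_apply continuous_const

/-- `v = (∂ₑ - i a) u` in the sense of distributions on the half-plane. -/
def IsWeakMagneticDeriv (e : ℝ × ℝ) (a : ℝ × ℝ → ℝ) (u v : ℝ × ℝ → ℂ) : Prop :=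
  ∀ φ : ℝ × ℝ → ℂ, ContDiff ℝ ∞ φ → HasCompactSupport φ → tsupport φ ⊆ halfPlane →
    ∫ x, v x * φ x ∂vol = -∫ x, u x * (fderiv ℝ φ x e + Complex.I * (a x : ℂ) * φ x) ∂vol

/-- `∂ₑ (χ u)` when `v = (∂ₑ - i a) u`. -/
def cutoffDeriv (χ : ℝ × ℝ → ℂ) (e : ℝ × ℝ) (a : ℝ × ℝ → ℝ) (u v : ℝ × ℝ → ℂ) (x : ℝ × ℝ) : ℂ :=
  χ x * v x + (Complex.I * (a x : ℂ) * χ x) * u x + fderiv ℝ χ x e * u x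

theorem memLp_cutoffDeriv (hu : MemLp u 2 vol) (hv : MemLp v 2 vol) (ha : Continuous a)
    (hχ : ContDiff ℝ ∞ χ) (hs : HasCompactSupport χ) : MemLp (cutoffDeriv χ e a u v) 2 vol := by
  have hχc := hχ.continuous
  exact ((memLp_mul_of_hasCompactSupport hv hχ.continuous hs).add
    (memLp_mul_of_hasCompactSupport hu (by fun_prop) hs.mul_left)).add
    (memLp_mul_of_hasCompactSupport hu (continuous_fderiv_test hχ) (hs.fderiv_apply ℝ e))

/-- The potential term is moved into the right-hand side, leaving an ordinary weak derivative.
Unlike the magnetic derivative, it commutes with convolution; on the support of a compactly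
supported χ the potential is bounded, so nothing leaves L². -/
theorem IsWeakMagneticDeriv.cutoff (h : IsWeakMagneticDeriv e a u v) (hu : MemLp u 2 vol)
    (hv : MemLp v 2 vol) (ha : Continuous a)
    (hχ : ContDiff ℝ ∞ χ) :
    IsWeakMagneticDeriv e 0 (fun x => χ x * u x) (cutoffDeriv χ e a u v) := by
  intro ψ hψ hψs hψt
  have hχc := hχ.continuous
  have hψc := hψ.continuous
  have hχ' := continuous_fderiv_test (e := e) hχ
  have hψ' := continuous_fderiv_test (e := e) hψ
  have key := h (fun x => χ x * ψ x) (hχ.mul hψ) hψs.mul_left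
    ((tsupport_mul_subset_right (f := χ)).trans hψt)
  have hd : ∀ x, fderiv ℝ (fun x => χ x * ψ x) x e = fderiv ℝ χ x e * ψ x + χ x * fderiv ℝ ψ x e :=
    fun x => by
      rw [fderiv_fun_mul (hχ.differentiable (by simp) x) (hψ.differentiable (by simp) x)]
      simp; ring
  have hψs' : HasCompactSupport fun x => fderiv ℝ ψ x e := hψs.fderiv_apply ℝ e
  have i1 : Integrable (fun x => v x * (χ x * ψ x)) vol :=
    integrable_mul_of_hasCompactSupport hv (hχc.mul hψc) hψs.mul_left
  have i2 : Integrable (fun x => u x * ((fderiv ℝ χ x e + Complex.I * a x * χ x) * ψ x)) vol :=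
    integrable_mul_of_hasCompactSupport hu (by fun_prop) hψs.mul_left
  have i3 : Integrable (fun x => u x * (χ x * fderiv ℝ ψ x e)) vol :=
    integrable_mul_of_hasCompactSupport hu (by fun_prop) hψs'.mul_left
  have e1 : ∫ x, u x * (fderiv ℝ (fun x => χ x * ψ x) x e + Complex.I * a x * (χ x * ψ x)) ∂vol =
      ∫ x, u x * ((fderiv ℝ χ x e + Complex.I * a x * χ x) * ψ x) ∂vol +
        ∫ x, u x * (χ x * fderiv ℝ ψ x e) ∂vol := by
    rw [← integral_add i2 i3]
    congr 1; ext x; rw [hd]; ring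
  have e2 : ∫ x, cutoffDeriv χ e a u v x * ψ x ∂vol = ∫ x, v x * (χ x * ψ x) ∂vol +
      ∫ x, u x * ((fderiv ℝ χ x e + Complex.I * a x * χ x) * ψ x) ∂vol := by
    rw [← integral_add i1 i2]
    congr 1; ext x; rw [cutoffDeriv]; ring
  have e3 : ∫ x, χ x * u x * (fderiv ℝ ψ x e + Complex.I * ((0 : ℝ × ℝ → ℝ) x : ℂ) * ψ x) ∂vol =
      ∫ x, u x * (χ x * fderiv ℝ ψ x e) ∂vol := by
    congr 1; ext x; simp; ring
  rw [e2, e3, key, e1]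
  ring

/-- Convolution of the extension by zero of `f` with `ρ`. -/
def mollify (ρ f : ℝ × ℝ → ℂ) : ℝ × ℝ → ℂ :=
  halfPlane.indicator f ⋆[ContinuousLinearMap.mul ℝ ℂ, volume] ρ

theorem mollify_apply (ρ f : ℝ × ℝ → ℂ) (x : ℝ × ℝ) :
    mollify ρ f x = ∫ t, f t * ρ (x - t) ∂vol := by
  rw [mollify, convolution_def, vol, ← integral_indicator isOpen_halfPlane.measurableSet]
  congr 1; ext t
  by_cases ht : t ∈ halfPlane <;> simp [ht]

theorem memLp_indicator_halfPlane (hf : MemLp f 2 vol) :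
    MemLp (halfPlane.indicator f) 2 volume :=
  (memLp_indicator_iff_restrict isOpen_halfPlane.measurableSet).2 hf

theorem locallyIntegrable_indicator_halfPlane (hf : MemLp f 2 vol) :
    LocallyIntegrable (halfPlane.indicator f) :=
  (memLp_indicator_halfPlane hf).locallyIntegrable (by norm_num)

theorem contDiff_mollify (hf : MemLp f 2 vol) (hρ : ContDiff ℝ ∞ ρ) (hs : HasCompactSupport ρ) :
    ContDiff ℝ ∞ (mollify ρ f) :=
  hs.contDiff_convolution_right _ (locallyIntegrable_indicator_halfPlane hf) hρ

/-- The kernel lives in z₂ < 0, so for x₂ ≥ 0 the function t ↦ ρ(x - t) is supported in t₂ > x₂ ≥ 0.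
It is therefore an admissible interior test function, and extension by zero creates no boundary
term. -/
theorem fderiv_mollify (h : IsWeakMagneticDeriv e 0 f f') (hf : MemLp f 2 vol)
    (hρ : ContDiff ℝ ∞ ρ) (hs : HasCompactSupport ρ) (ht : ∀ z ∈ tsupport ρ, z.2 < 0)
    {x : ℝ × ℝ} (hx : 0 ≤ x.2) : fderiv ℝ (mollify ρ f) x e = mollify ρ f' x := by
  have hloc := locallyIntegrable_indicator_halfPlane hf
  have hρ1 : ContDiff ℝ 1 ρ := hρ.of_le (by exact_mod_cast le_top)
  have h1 := (hs.hasFDerivAt_convolution_right (ContinuousLinearMap.mul ℝ ℂ) hloc hρ1 x).fderiv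
  have h2 := convolution_precompR_apply (ContinuousLinearMap.mul ℝ ℂ) hloc (hs.fderiv ℝ)
    (hρ1.continuous_fderiv one_ne_zero) x e
  set ψ : ℝ × ℝ → ℂ := fun t => ρ (x - t) with hψ
  have hψd : ContDiff ℝ ∞ ψ := hρ.comp (contDiff_const.sub contDiff_id)
  have hψs : HasCompactSupport ψ := hs.comp_homeomorph (Homeomorph.subLeft x)
  have hψt : tsupport ψ ⊆ halfPlane := fun t htt => by
    have : x - t ∈ tsupport ρ :=
      (tsupport_comp_subset_preimage ρ (by fun_prop : Continuous fun t => x - t)) htt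
    have := ht _ this
    simp only [Prod.snd_sub] at this
    show 0 < t.2
    linarith
  have hψ' : ∀ t, fderiv ℝ ψ t e = -(fderiv ℝ ρ (x - t) e) := fun t => by
    have hd := ((hρ1.differentiable one_ne_zero (x - t)).hasFDerivAt).comp t
      ((hasFDerivAt_id t).const_sub x)
    rw [show ψ = ρ ∘ fun t => x - t from rfl, hd.fderiv]
    simp
  have key := h ψ hψd hψs hψt
  have : fderiv ℝ (mollify ρ f) x e = mollify (fun y => fderiv ℝ ρ y e) f x := by
    rw [mollify, h1, h2]; rfl
  rw [this, mollify_apply, mollify_apply, key, ← integral_neg]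
  congr 1; ext t
  simp [hψ']

theorem eLpNorm_mollify_sub_le (hf : MemLp f 2 vol) {ρ : ℝ × ℝ → ℝ}
    (hρ : Continuous ρ) (hs : HasCompactSupport ρ) (h0 : ∀ z, 0 ≤ ρ z) (h1 : ∫ z, ρ z = 1)
    {ε : ℝ≥0∞} (hε : ∀ z ∈ tsupport ρ, eLpNorm (fun x => halfPlane.indicator f (x - z)
      - halfPlane.indicator f x) 2 volume ≤ ε) :
    eLpNorm (fun x => mollify (fun z => (ρ z : ℂ)) f x - f x) 2 vol ≤ ε := by
  refine le_trans ?_ (eLpNorm_average_sub_le (memLp_indicator_halfPlane hf) hρ hs h0 h1 hε)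
  refine le_trans (le_of_eq (eLpNorm_congr_ae ?_)) (eLpNorm_mono_measure _ Measure.restrict_le_self)
  filter_upwards [ae_restrict_mem isOpen_halfPlane.measurableSet] with x hx
  rw [mollify, convolution_eq_swap, indicator_of_mem hx]
  rfl

/-- A bump of radius δ/4 centred at (0, -δ/2) stays below the axis and inside the δ-ball. -/
theorem exists_mollifier {δ : ℝ} (hδ : 0 < δ) : ∃ ρ : ℝ × ℝ → ℝ, ContDiff ℝ ∞ ρ ∧
    HasCompactSupport ρ ∧ (∀ z, 0 ≤ ρ z) ∧ ∫ z, ρ z = 1 ∧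
      ∀ z ∈ tsupport ρ, z.2 < 0 ∧ ‖z‖ < δ := by
  let b : ContDiffBump ((0, -(δ / 2)) : ℝ × ℝ) := ⟨δ / 8, δ / 4, by linarith, by linarith⟩
  refine ⟨b.normed volume, b.contDiff_normed, b.hasCompactSupport_normed, b.nonneg_normed,
    b.integral_normed, fun z hz => ?_⟩
  rw [b.tsupport_normed_eq, Metric.mem_closedBall, Prod.dist_eq, max_le_iff, Real.dist_eq,
    Real.dist_eq] at hz
  have h1 := abs_le.1 hz.1
  have h2 := abs_le.1 hz.2
  simp only [b] at h1 h2
  refine ⟨by linarith [h2.2], ?_⟩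
  rw [Prod.norm_def, max_lt_iff, Real.norm_eq_abs, Real.norm_eq_abs, abs_lt, abs_lt]
  constructor <;> constructor <;> linarith [h1.1, h1.2, h2.1, h2.2]

end Mollification

section Density

variable {f f' u v v₁ v₂ χ ψ : ℝ × ℝ → ℂ} {e : ℝ × ℝ} {a : ℝ × ℝ → ℝ}

/-- On the half-plane, the difference is the mollification error of `cutoffDeriv` minus i a times
that of χu. The latter is supported in ‖x‖ ≤ R + 1, since the kernel moves points by less than 1,
and there |a| ≤ R + 1. -/
theorem eLpNorm_deriv_mollify_sub_le (h : IsWeakMagneticDeriv e a u v) (hu : MemLp u 2 vol)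
    (hv : MemLp v 2 vol) (ha : Continuous a) (haB : ∀ x, ‖a x‖ ≤ ‖x‖)
    (hχ : ContDiff ℝ ∞ χ) (hs : HasCompactSupport χ) {R : ℝ}
    (hχR : ∀ x, χ x ≠ 0 → ‖x‖ ≤ R) {ρ : ℝ × ℝ → ℝ} (hρ : ContDiff ℝ ∞ ρ)
    (hρs : HasCompactSupport ρ) (h0 : ∀ z, 0 ≤ ρ z) (h1 : ∫ z, ρ z = 1)
    (ht : ∀ z ∈ tsupport ρ, z.2 < 0 ∧ ‖z‖ < 1) {ε : ℝ≥0∞}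
    (hε : ∀ z ∈ tsupport ρ, eLpNorm (fun x => halfPlane.indicator (fun x => χ x * u x) (x - z)
      - halfPlane.indicator (fun x => χ x * u x) x) 2 volume ≤ ε)
    (hε' : ∀ z ∈ tsupport ρ, eLpNorm (fun x => halfPlane.indicator (cutoffDeriv χ e a u v) (x - z)
      - halfPlane.indicator (cutoffDeriv χ e a u v) x) 2 volume ≤ ε) :
    eLpNorm (fun x => (fderiv ℝ (mollify (fun z => (ρ z : ℂ)) fun x => χ x * u x) x e
      - Complex.I * (a x : ℂ) * mollify (fun z => (ρ z : ℂ)) (fun x => χ x * u x) x)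
      - (χ x * v x + fderiv ℝ χ x e * u x)) 2 vol ≤ ε + ENNReal.ofReal (R + 1) * ε := by
  set F : ℝ × ℝ → ℂ := fun x => χ x * u x with hF
  set G := cutoffDeriv χ e a u v with hG
  have hFm : MemLp F 2 vol := memLp_mul_of_hasCompactSupport hu hχ.continuous hs
  have hGm : MemLp G 2 vol := memLp_cutoffDeriv hu hv ha hχ hs
  set r : ℝ × ℝ → ℂ := fun z => (ρ z : ℂ) with hr
  have hrd : ContDiff ℝ ∞ r := Complex.ofRealCLM.contDiff.comp hρ
  have hrs : HasCompactSupport r := hρs.comp_left Complex.ofReal_zero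
  have hrt : tsupport r ⊆ tsupport ρ := closure_mono fun z hz hz0 => hz (by simp [hr, hz0])
  have e1 := eLpNorm_mollify_sub_le hFm hρ.continuous hρs h0 h1 hε
  have e2 := eLpNorm_mollify_sub_le hGm hρ.continuous hρs h0 h1 hε'
  have hsupp : ∀ x, R + 1 < ‖x‖ → mollify r F x = 0 := fun x hx => by
    rw [mollify_apply]
    refine integral_eq_zero_of_ae (Filter.Eventually.of_forall fun t => ?_)
    by_contra hne
    simp only [Pi.zero_apply, hF] at hne
    have hχt : χ t ≠ 0 := fun h => hne (by simp [h])
    have hrt' : r (x - t) ≠ 0 := fun h => hne (by simp [h])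
    have l1 := hχR t hχt
    have l2 := (ht _ (hrt (subset_tsupport r hrt'))).2
    have := norm_add_le (x - t) t
    rw [sub_add_cancel] at this
    linarith
  have m1 : AEStronglyMeasurable (fun x => mollify r F x - F x) vol :=
    (contDiff_mollify hFm hrd hrs).continuous.aestronglyMeasurable.sub hFm.1
  have m2 : AEStronglyMeasurable (fun x => mollify r G x - G x) vol :=
    (contDiff_mollify hGm hrd hrs).continuous.aestronglyMeasurable.sub hGm.1
  have m3 : AEStronglyMeasurable (fun x => Complex.I * (a x : ℂ) * (mollify r F x - F x)) vol :=
    (by fun_prop : Continuous fun x => Complex.I * (a x : ℂ)).aestronglyMeasurable.mul m1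
  calc _ = eLpNorm ((fun x => mollify r G x - G x)
        - fun x => Complex.I * (a x : ℂ) * (mollify r F x - F x)) 2 vol := by
        refine eLpNorm_congr_ae ?_
        filter_upwards [ae_restrict_mem isOpen_halfPlane.measurableSet] with x hx
        rw [fderiv_mollify (h.cutoff hu hv ha hχ) hFm hrd hrs (fun z hz => (ht z (hrt hz)).1)
          (le_of_lt hx)]
        simp only [Pi.sub_apply, ← hG]
        rw [hG, cutoffDeriv]
        ring
    _ ≤ eLpNorm (fun x => mollify r G x - G x) 2 vol
        + eLpNorm (fun x => Complex.I * (a x : ℂ) * (mollify r F x - F x)) 2 vol :=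
      eLpNorm_sub_le m2 m3 (by norm_num)
    _ ≤ ε + ENNReal.ofReal (R + 1) * ε := by
      refine add_le_add e2 ((eLpNorm_le_mul_eLpNorm_of_ae_le_mul (c := R + 1) (p := 2)
        (g := fun x => mollify r F x - F x)
        (Filter.Eventually.of_forall fun x => ?_)).trans (by gcongr))
      rw [norm_mul, norm_mul, Complex.norm_I, one_mul, Complex.norm_real]
      by_cases hx : ‖x‖ ≤ R + 1
      · exact mul_le_mul_of_nonneg_right ((haB x).trans hx) (norm_nonneg _)
      · have z1 := hsupp x (not_le.1 hx)
        have z2 : F x = 0 := by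
          by_contra hne
          have := hχR x fun h => hne (by simp [hF, h])
          linarith
        simp [z1, z2]

theorem MemMagneticH1.isWeakMagneticDeriv₁ (h : MemMagneticH1 u v₁ v₂) :
    IsWeakMagneticDeriv (1, 0) A₁ u v₁ := fun φ h1 h2 h3 => (h.isMagneticGradient φ h1 h2 h3).1

theorem MemMagneticH1.isWeakMagneticDeriv₂ (h : MemMagneticH1 u v₁ v₂) :
    IsWeakMagneticDeriv (0, 1) A₂ u v₂ := fun φ h1 h2 h3 => (h.isMagneticGradient φ h1 h2 h3).2

theorem norm_A₁_le (x : ℝ × ℝ) : ‖A₁ x‖ ≤ ‖x‖ := by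
  have : ‖A₁ x‖ = ‖x.2‖ / 2 := by rw [A₁, norm_div, norm_neg]; simp
  have := norm_snd_le x
  have := norm_nonneg x.2
  linarith

theorem norm_A₂_le (x : ℝ × ℝ) : ‖A₂ x‖ ≤ ‖x‖ := by
  have : ‖A₂ x‖ = ‖x.1‖ / 2 := by rw [A₂, norm_div]; simp
  have := norm_fst_le x
  have := norm_nonneg x.1
  linarith

/-- Approximation of a truncated `H¹` function by test functions. -/
theorem exists_approx_cutoff (h : MemMagneticH1 u v₁ v₂) (hχ : ContDiff ℝ ∞ χ)
    (hs : HasCompactSupport χ) {ε : ℝ≥0∞} (hε : ε ≠ 0) :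
    ∃ φ : ℝ × ℝ → ℂ, ContDiff ℝ ∞ φ ∧ HasCompactSupport φ ∧
      eLpNorm (fun x => φ x - χ x * u x) 2 vol ≤ ε ∧
      eLpNorm (fun x => D₁ φ x - (χ x * v₁ x + pd₁ χ x * u x)) 2 vol ≤ ε ∧
      eLpNorm (fun x => D₂ φ x - (χ x * v₂ x + pd₂ χ x * u x)) 2 vol ≤ ε := by
  obtain ⟨R, hχR⟩ : ∃ R : ℝ, ∀ x, χ x ≠ 0 → ‖x‖ ≤ R := by
    obtain ⟨R, hR⟩ := hs.isCompact.isBounded.exists_norm_le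
    exact ⟨R, fun x hx => hR x (subset_tsupport χ hx)⟩
  -- This is the factor lost in `eLpNorm_deriv_mollify_sub_le`; translation errors of size ε / C
  -- therefore suffice.
  set C : ℝ≥0∞ := 1 + ENNReal.ofReal (R + 1) with hC
  have hCtop : C ≠ ⊤ := by simp [hC]
  have hC1 : 1 ≤ C := le_self_add
  set η := ε / C with hη
  have hη0 : 0 < η := ENNReal.div_pos hε hCtop
  have hηε : η + ENNReal.ofReal (R + 1) * η = ε := by
    have : η + ENNReal.ofReal (R + 1) * η = C * η := by rw [hC]; ring
    rw [this, hη, ENNReal.mul_div_cancel (by positivity) hCtop]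
  have hηle : η ≤ ε := by rw [← hηε]; exact le_self_add
  have hw₁ := h.isWeakMagneticDeriv₁
  have hw₂ := h.isWeakMagneticDeriv₂
  have hF := memLp_mul_of_hasCompactSupport h.memLp hχ.continuous hs
  have t0 := tendsto_eLpNorm_translate (memLp_indicator_halfPlane hF)
  have t1 := tendsto_eLpNorm_translate (memLp_indicator_halfPlane
    (memLp_cutoffDeriv (e := (1, 0)) h.memLp h.memLp₁ continuous_A₁ hχ hs))
  have t2 := tendsto_eLpNorm_translate (memLp_indicator_halfPlane
    (memLp_cutoffDeriv (e := (0, 1)) h.memLp h.memLp₂ continuous_A₂ hχ hs))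
  obtain ⟨δ, hδ, hball⟩ := Metric.eventually_nhds_iff.1 ((t0.eventually (gt_mem_nhds hη0)).and
    ((t1.eventually (gt_mem_nhds hη0)).and (t2.eventually (gt_mem_nhds hη0))))
  obtain ⟨ρ, hρ, hρs, h0, h1, ht⟩ := exists_mollifier (lt_min hδ one_pos)
  have hb : ∀ z ∈ tsupport ρ, dist z 0 < δ := fun z hz => by
    rw [dist_zero_right]; exact (ht z hz).2.trans_le (min_le_left _ _)
  have ht' : ∀ z ∈ tsupport ρ, z.2 < 0 ∧ ‖z‖ < 1 := fun z hz =>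
    ⟨(ht z hz).1, (ht z hz).2.trans_le (min_le_right _ _)⟩
  have hrd : ContDiff ℝ ∞ fun z => (ρ z : ℂ) := Complex.ofRealCLM.contDiff.comp hρ
  have hrs : HasCompactSupport fun z => (ρ z : ℂ) := hρs.comp_left Complex.ofReal_zero
  refine ⟨mollify (fun z => (ρ z : ℂ)) fun x => χ x * u x, contDiff_mollify hF hrd hrs, ?_,
    (eLpNorm_mollify_sub_le hF hρ.continuous hρs h0 h1 fun z hz =>
      (hball (hb z hz)).1.le).trans hηle, ?_, ?_⟩
  · refine HasCompactSupport.convolution _ ?_ hrs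
    refine hs.mono fun x hx hx0 => hx ?_
    by_cases hxh : x ∈ halfPlane <;> simp [hxh, hx0]
  · rw [← hηε]
    exact eLpNorm_deriv_mollify_sub_le hw₁ h.memLp h.memLp₁ continuous_A₁ norm_A₁_le hχ hs hχR hρ
      hρs h0 h1 ht' (fun z hz => (hball (hb z hz)).1.le) (fun z hz => (hball (hb z hz)).2.1.le)
  · rw [← hηε]
    exact eLpNorm_deriv_mollify_sub_le hw₂ h.memLp h.memLp₂ continuous_A₂ norm_A₂_le hχ hs hχR hρ
      hρs h0 h1 ht' (fun z hz => (hball (hb z hz)).1.le) (fun z hz => (hball (hb z hz)).2.2.le)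

end Density

/-! ### Truncation at infinity and density of test functions -/

open scoped ENNReal Convolution Topology ComplexConjugate
open Filter

section Truncation

variable {f u v₁ v₂ : ℝ × ℝ → ℂ}

/-- Smooth cutoff functions exhausting the plane. -/
def cutoff (n : ℕ) (x : ℝ × ℝ) : ℂ :=
  ((⟨1, 2, one_pos, one_lt_two⟩ : ContDiffBump (0 : ℝ × ℝ)) (((n : ℝ) + 1)⁻¹ • x) : ℝ)

theorem contDiff_cutoff (n : ℕ) : ContDiff ℝ ∞ (cutoff n) :=
  Complex.ofRealCLM.contDiff.comp
    ((ContDiffBump.contDiff _).comp (contDiff_const_smul _))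

theorem hasCompactSupport_cutoff (n : ℕ) : HasCompactSupport (cutoff n) := by
  have h : ((n : ℝ) + 1)⁻¹ ≠ 0 := by positivity
  exact ((ContDiffBump.hasCompactSupport _).comp_homeomorph
    (Homeomorph.smulOfNeZero _ h)).comp_left Complex.ofReal_zero

theorem norm_cutoff_sub_one_le (n : ℕ) (x : ℝ × ℝ) : ‖cutoff n x - 1‖ ≤ 1 := by
  set b : ContDiffBump (0 : ℝ × ℝ) := ⟨1, 2, one_pos, one_lt_two⟩
  have h0 := b.nonneg (x := ((n : ℝ) + 1)⁻¹ • x)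
  have h1 := b.le_one (x := ((n : ℝ) + 1)⁻¹ • x)
  have : cutoff n x - 1 = ((b (((n : ℝ) + 1)⁻¹ • x) - 1 : ℝ) : ℂ) := by simp [cutoff, b]
  rw [this, Complex.norm_real, Real.norm_eq_abs, abs_le]
  constructor <;> linarith

theorem cutoff_eq_one {n : ℕ} {x : ℝ × ℝ} (h : ‖x‖ ≤ n) : cutoff n x = 1 := by
  have hn : (0 : ℝ) < (n : ℝ) + 1 := by positivity
  rw [cutoff, ContDiffBump.one_of_mem_closedBall, Complex.ofReal_one]
  rw [mem_closedBall_zero_iff, norm_smul, norm_inv, Real.norm_of_nonneg hn.le,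
    inv_mul_le_iff₀ hn]
  linarith

/-- All cutoffs are dilations of the first one, so their gradients decay like 1/(n + 1). -/
theorem exists_fderiv_cutoff_bound : ∃ C : ℝ, ∀ (n : ℕ) (x e : ℝ × ℝ), ‖e‖ ≤ 1 →
    ‖fderiv ℝ (cutoff n) x e‖ ≤ C * (1 / ((n : ℝ) + 1)) := by
  obtain ⟨C, hC⟩ := ((hasCompactSupport_cutoff 0).fderiv ℝ).exists_bound_of_continuous
    ((contDiff_cutoff 0).continuous_fderiv (by simp))
  refine ⟨C, fun n x e he => ?_⟩
  have hn : (0 : ℝ) < (n : ℝ) + 1 := by positivity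
  have h1 : cutoff n = fun x => cutoff 0 (((n : ℝ) + 1)⁻¹ • x) := by
    ext x; simp [cutoff]
  rw [h1, fderiv_comp_smul, smul_apply, norm_smul, norm_inv,
    Real.norm_of_nonneg hn.le, one_div, mul_comm C]
  refine mul_le_mul_of_nonneg_left ?_ (by positivity)
  refine (ContinuousLinearMap.le_opNorm _ _).trans ?_
  have := hC (((n : ℝ) + 1)⁻¹ • x)
  nlinarith [norm_nonneg e, norm_nonneg (fderiv ℝ (cutoff 0) (((n : ℝ) + 1)⁻¹ • x))]

theorem tendsto_zero_of_sq {ι : Type*} {l : Filter ι} {g : ι → ℝ≥0∞}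
    (h : Tendsto (fun i => g i ^ 2) l (𝓝 0)) : Tendsto g l (𝓝 0) := by
  have := (ENNReal.continuous_rpow_const (y := 1 / 2)).tendsto (0 : ℝ≥0∞) |>.comp h
  rw [ENNReal.zero_rpow_of_pos (by norm_num)] at this
  refine this.congr fun i => ?_
  simp only [Function.comp]
  rw [← ENNReal.rpow_ofNat, ← ENNReal.rpow_mul]
  norm_num

theorem tendsto_cutoff_mul_sub (hf : MemLp f 2 vol) :
    Tendsto (fun n => eLpNorm (fun x => cutoff n x * f x - f x) 2 vol) atTop (𝓝 0) := by
  refine tendsto_zero_of_sq ?_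
  simp only [sq_eLpNorm_two]
  have hfin : ∫⁻ x, ‖f x‖ₑ ^ 2 ∂vol ≠ ⊤ := by
    rw [← sq_eLpNorm_two]; exact ENNReal.pow_ne_top hf.2.ne
  have := tendsto_lintegral_of_dominated_convergence' (μ := vol)
    (F := fun n x => ‖cutoff n x * f x - f x‖ₑ ^ 2) (f := fun _ => 0) (fun x => ‖f x‖ₑ ^ 2)
    (fun n =>
      (((contDiff_cutoff n).continuous.aestronglyMeasurable.mul hf.1).sub hf.1).enorm.pow_const 2)
    (fun n => Eventually.of_forall fun x => ?_) hfin
    (Eventually.of_forall fun x => ?_)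
  · simpa using this
  · refine pow_le_pow_left₀ zero_le (enorm_le_iff_norm_le.2 ?_) 2
    have : cutoff n x * f x - f x = (cutoff n x - 1) * f x := by ring
    rw [this, norm_mul]
    exact mul_le_of_le_one_left (norm_nonneg _) (norm_cutoff_sub_one_le n x)
  · obtain ⟨N, hN⟩ := exists_nat_ge ‖x‖
    refine tendsto_const_nhds.congr' ?_
    filter_upwards [eventually_ge_atTop N] with n hn
    rw [cutoff_eq_one (hN.trans (by exact_mod_cast hn))]
    simp

theorem tendsto_fderiv_cutoff_mul (hf : MemLp f 2 vol) {e : ℝ × ℝ} (he : ‖e‖ ≤ 1) :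
    Tendsto (fun n => eLpNorm (fun x => fderiv ℝ (cutoff n) x e * f x) 2 vol) atTop (𝓝 0) := by
  obtain ⟨C, hC⟩ := exists_fderiv_cutoff_bound
  have hlim : Tendsto (fun n : ℕ => ENNReal.ofReal (C * (1 / ((n : ℝ) + 1))) * eLpNorm f 2 vol)
      atTop (𝓝 0) := by
    have h1 : Tendsto (fun n : ℕ => C * (1 / ((n : ℝ) + 1))) atTop (𝓝 0) := by
      simpa using tendsto_one_div_add_atTop_nhds_zero_nat.const_mul C
    have h2 := ENNReal.Tendsto.mul_const (b := eLpNorm f 2 vol) (ENNReal.tendsto_ofReal h1)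
      (Or.inr hf.2.ne)
    simpa using h2
  refine tendsto_of_tendsto_of_tendsto_of_le_of_le tendsto_const_nhds hlim (fun _ => zero_le)
    fun n => eLpNorm_le_mul_eLpNorm_of_ae_le_mul (Eventually.of_forall fun x => ?_) 2
  rw [norm_mul]
  exact mul_le_mul_of_nonneg_right (hC n x e he) (norm_nonneg _)

/-- Three errors of size ε/3 add up: approximation of the truncated function, truncation of the
target, and the commutator term u ∂χ, which vanishes as the cutoff widens. -/
theorem exists_approx (h : MemMagneticH1 u v₁ v₂) {ε : ℝ≥0∞} (hε : ε ≠ 0) :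
    ∃ φ : ℝ × ℝ → ℂ, ContDiff ℝ ∞ φ ∧ HasCompactSupport φ ∧
      eLpNorm (φ - u) 2 vol ≤ ε ∧ eLpNorm (D₁ φ - v₁) 2 vol ≤ ε ∧
      eLpNorm (D₂ φ - v₂) 2 vol ≤ ε := by
  have hε3 : 0 < ε / 3 := ENNReal.div_pos hε (by norm_num)
  have c0 := (tendsto_cutoff_mul_sub h.memLp).eventually (gt_mem_nhds hε3)
  have c1 := (tendsto_cutoff_mul_sub h.memLp₁).eventually (gt_mem_nhds hε3)
  have c2 := (tendsto_cutoff_mul_sub h.memLp₂).eventually (gt_mem_nhds hε3)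
  have d1 := (tendsto_fderiv_cutoff_mul h.memLp (e := (1, 0)) (by simp [Prod.norm_def])).eventually
    (gt_mem_nhds hε3)
  have d2 := (tendsto_fderiv_cutoff_mul h.memLp (e := (0, 1)) (by simp [Prod.norm_def])).eventually
    (gt_mem_nhds hε3)
  obtain ⟨n, c0, c1, c2, d1, d2⟩ := (c0.and (c1.and (c2.and (d1.and d2)))).exists
  obtain ⟨φ, hφ, hs, a0, a1, a2⟩ := exists_approx_cutoff h (contDiff_cutoff n)
    (hasCompactSupport_cutoff n) hε3.ne'
  have hφ1 : ContDiff ℝ 1 φ := hφ.of_le (by exact_mod_cast le_top)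
  have hχ := contDiff_cutoff n
  have hχc := hχ.continuous
  have mc : ∀ {f : ℝ × ℝ → ℂ}, MemLp f 2 vol →
      AEStronglyMeasurable (fun x => cutoff n x * f x) vol := fun hf =>
    hχc.aestronglyMeasurable.mul hf.1
  have md : ∀ e : ℝ × ℝ, AEStronglyMeasurable (fun x => fderiv ℝ (cutoff n) x e * u x) vol :=
    fun e => (continuous_fderiv_test hχ).aestronglyMeasurable.mul h.memLp.1
  have hthird : ε / 3 + ε / 3 + ε / 3 = ε := ENNReal.add_thirds ε
  have step : ∀ {D v d : ℝ × ℝ → ℂ}, AEStronglyMeasurable D vol → MemLp v 2 vol →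
      AEStronglyMeasurable d vol →
      eLpNorm (fun x => D x - (cutoff n x * v x + d x)) 2 vol ≤ ε / 3 →
      eLpNorm (fun x => cutoff n x * v x - v x) 2 vol ≤ ε / 3 → eLpNorm d 2 vol ≤ ε / 3 →
      eLpNorm (D - v) 2 vol ≤ ε := by
    intro D v d hD hv hd b1 b2 b3
    have e1 : D - v = (fun x => D x - (cutoff n x * v x + d x)) +
        (fun x => cutoff n x * v x - v x) + d := by
      ext x; simp only [Pi.sub_apply, Pi.add_apply]; ring
    have m1 : AEStronglyMeasurable (fun x => D x - (cutoff n x * v x + d x)) vol :=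
      hD.sub ((mc hv).add hd)
    have m2 : AEStronglyMeasurable (fun x => cutoff n x * v x - v x) vol := (mc hv).sub hv.1
    rw [e1, ← hthird]
    exact (eLpNorm_add_le (m1.add m2) hd (by norm_num)).trans
      (add_le_add ((eLpNorm_add_le m1 m2 (by norm_num)).trans (add_le_add b1 b2)) b3)
  refine ⟨φ, hφ, hs, ?_, ?_, ?_⟩
  · exact step (d := fun _ => 0) hφ.continuous.aestronglyMeasurable h.memLp
      aestronglyMeasurable_const (by simpa using a0) c0.le (by simp)
  · exact step (continuous_D₁ hφ1).aestronglyMeasurable h.memLp₁ (md (1, 0)) a1 c1.le d1.le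
  · exact step (continuous_D₂ hφ1).aestronglyMeasurable h.memLp₂ (md (0, 1)) a2 c2.le d2.le

/-- Test functions are dense in the magnetic Sobolev space. -/
theorem exists_seq_approx (h : MemMagneticH1 u v₁ v₂) :
    ∃ φ : ℕ → ℝ × ℝ → ℂ, (∀ n, ContDiff ℝ ∞ (φ n)) ∧ (∀ n, HasCompactSupport (φ n)) ∧
      Tendsto (fun n => eLpNorm (φ n - u) 2 vol) atTop (𝓝 0) ∧
      Tendsto (fun n => eLpNorm (D₁ (φ n) - v₁) 2 vol) atTop (𝓝 0) ∧
      Tendsto (fun n => eLpNorm (D₂ (φ n) - v₂) 2 vol) atTop (𝓝 0) := by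
  have hpos : ∀ n : ℕ, ((n : ℝ≥0∞) + 1)⁻¹ ≠ 0 := fun n =>
    ENNReal.inv_ne_zero.2 (by finiteness)
  choose φ h1 h2 h3 h4 h5 using fun n : ℕ => exists_approx h (hpos n)
  have hlim : Tendsto (fun n : ℕ => ((n : ℝ≥0∞) + 1)⁻¹) atTop (𝓝 0) := by
    have := (tendsto_add_atTop_iff_nat 1).2 ENNReal.tendsto_inv_nat_nhds_zero
    simpa using this
  exact ⟨φ, h1, h2,
    tendsto_of_tendsto_of_tendsto_of_le_of_le tendsto_const_nhds hlim (fun _ => zero_le) h3,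
    tendsto_of_tendsto_of_tendsto_of_le_of_le tendsto_const_nhds hlim (fun _ => zero_le) h4,
    tendsto_of_tendsto_of_tendsto_of_le_of_le tendsto_const_nhds hlim (fun _ => zero_le) h5⟩

end Truncation

/-! ### Limits of L² norms and pairings -/

section Limits

variable {α : Type*} [MeasurableSpace α] {μ : Measure α}

theorem inner_toLp_eq {f g : α → ℂ} (hf : MemLp f 2 μ) (hg : MemLp g 2 μ) :
    inner ℂ (hf.toLp f) (hg.toLp g) = ∫ x, g x * conj (f x) ∂μ := by
  rw [L2.inner_def]
  refine integral_congr_ae ?_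
  filter_upwards [hf.coeFn_toLp, hg.coeFn_toLp] with x h1 h2
  rw [h1, h2, RCLike.inner_apply]

theorem norm_sq_toLp_eq {f : α → ℂ} (hf : MemLp f 2 μ) :
    ‖hf.toLp f‖ ^ 2 = ∫ x, ‖f x‖ ^ 2 ∂μ := by
  have h := inner_toLp_eq hf hf
  rw [inner_self_eq_norm_sq_to_K] at h
  have e : ∀ x, f x * conj (f x) = ((‖f x‖ ^ 2 : ℝ) : ℂ) := fun x => by
    rw [Complex.mul_conj, Complex.normSq_eq_norm_sq]
  simp only [e, integral_complex_ofReal] at h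
  exact Complex.ofReal_injective (by rw [← h]; push_cast; rfl)

theorem tendsto_toLp {f : ℕ → α → ℂ} {g : α → ℂ} (hf : ∀ n, MemLp (f n) 2 μ) (hg : MemLp g 2 μ)
    (h : Tendsto (fun n => eLpNorm (f n - g) 2 μ) atTop (𝓝 0)) :
    Tendsto (fun n => (hf n).toLp (f n)) atTop (𝓝 (hg.toLp g)) :=
  (Lp.tendsto_Lp_iff_tendsto_eLpNorm'' f hf g hg).2 h

theorem tendsto_integral_norm_sq {f : ℕ → α → ℂ} {g : α → ℂ} (hf : ∀ n, MemLp (f n) 2 μ)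
    (hg : MemLp g 2 μ) (h : Tendsto (fun n => eLpNorm (f n - g) 2 μ) atTop (𝓝 0)) :
    Tendsto (fun n => ∫ x, ‖f n x‖ ^ 2 ∂μ) atTop (𝓝 (∫ x, ‖g x‖ ^ 2 ∂μ)) := by
  simpa only [norm_sq_toLp_eq] using ((tendsto_toLp hf hg h).norm.pow 2)

theorem tendsto_integral_mul_conj {f f' : ℕ → α → ℂ} {g g' : α → ℂ} (hf : ∀ n, MemLp (f n) 2 μ)
    (hg : MemLp g 2 μ) (h : Tendsto (fun n => eLpNorm (f n - g) 2 μ) atTop (𝓝 0))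
    (hf' : ∀ n, MemLp (f' n) 2 μ) (hg' : MemLp g' 2 μ)
    (h' : Tendsto (fun n => eLpNorm (f' n - g') 2 μ) atTop (𝓝 0)) :
    Tendsto (fun n => ∫ x, f n x * conj (f' n x) ∂μ) atTop (𝓝 (∫ x, g x * conj (g' x) ∂μ)) := by
  simpa only [inner_toLp_eq] using (tendsto_toLp hf' hg' h').inner (𝕜 := ℂ) (tendsto_toLp hf hg h)

/-- A bounded sequence converging weakly against a dense set converges weakly. -/
theorem tendsto_inner_of_dense {H : Type*} [NormedAddCommGroup H] [InnerProductSpace ℂ H]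
    {x : ℕ → H} {g : H} {D : Set H} (hD : Dense D) {M : ℝ} (hM : ∀ n, ‖x n‖ ≤ M)
    (h : ∀ p ∈ D, Tendsto (fun n => inner ℂ p (x n)) atTop (𝓝 (inner ℂ p g))) (q : H) :
    Tendsto (fun n => inner ℂ q (x n)) atTop (𝓝 (inner ℂ q g)) := by
  rw [Metric.tendsto_atTop]
  intro ε hε
  have hK : 0 < M + ‖g‖ + 1 := by
    have := (norm_nonneg _).trans (hM 0)
    positivity
  obtain ⟨p, hpD, hp⟩ := Metric.mem_closure_iff.1 (hD q) (ε / 2 / (M + ‖g‖ + 1)) (by positivity)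
  obtain ⟨N, hN⟩ := Metric.tendsto_atTop.1 (h p hpD) (ε / 2) (half_pos hε)
  refine ⟨N, fun n hn => ?_⟩
  have h1 := hN n hn
  rw [dist_eq_norm] at h1 hp ⊢
  have e : inner ℂ q (x n) - inner ℂ q g
      = inner ℂ (q - p) (x n - g) + (inner ℂ p (x n) - inner ℂ p g) := by
    simp only [inner_sub_left, inner_sub_right]; ring
  have h2 : ‖inner ℂ (q - p) (x n - g)‖ ≤ ‖q - p‖ * (M + ‖g‖ + 1) :=
    (norm_inner_le_norm _ _).trans (mul_le_mul_of_nonneg_left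
      ((norm_sub_le _ _).trans (by linarith [hM n])) (norm_nonneg _))
  have h3 : ‖q - p‖ * (M + ‖g‖ + 1) < ε / 2 := by rwa [lt_div_iff₀ hK] at hp
  rw [e]
  linarith [norm_add_le (inner ℂ (q - p) (x n - g)) (inner ℂ p (x n) - inner ℂ p g)]

end Limits

/-! ### The trace and lower bounds on the form domain -/

section Trace

variable {u v₁ v₂ φ : ℝ × ℝ → ℂ} {g : ℝ → ℂ}

theorem pd₂_conj_add (hφ : ContDiff ℝ ∞ φ) (x : ℝ × ℝ) :
    pd₂ (fun y => conj (φ y)) x + Complex.I * (A₂ x : ℂ) * conj (φ x) = conj (D₂ φ x) := by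
  have hd := (Complex.conjCLE.toContinuousLinearMap.hasFDerivAt.comp x
    (hφ.differentiable (by simp) x).hasFDerivAt).fderiv
  have : pd₂ (fun y => conj (φ y)) x = conj (pd₂ φ x) := by
    rw [pd₂, show (fun y => conj (φ y)) = Complex.conjCLE.toContinuousLinearMap ∘ φ from rfl, hd]
    rfl
  rw [this, D₂]
  simp

theorem memLp_test (hφ : ContDiff ℝ ∞ φ) (hs : HasCompactSupport φ) : MemLp φ 2 vol :=
  hφ.continuous.memLp_of_hasCompactSupport hs

theorem memLp_D₁_test (hφ : ContDiff ℝ ∞ φ) (hs : HasCompactSupport φ) : MemLp (D₁ φ) 2 vol :=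
  (continuous_D₁ (hφ.of_le (by exact_mod_cast le_top))).memLp_of_hasCompactSupport
    (hasCompactSupport_D₁ hs)

theorem memLp_D₂_test (hφ : ContDiff ℝ ∞ φ) (hs : HasCompactSupport φ) : MemLp (D₂ φ) 2 vol :=
  (continuous_D₂ (hφ.of_le (by exact_mod_cast le_top))).memLp_of_hasCompactSupport
    (hasCompactSupport_D₂ hs)

theorem memLp_boundary_test (hφ : ContDiff ℝ ∞ φ) (hs : HasCompactSupport φ) :
    MemLp (fun s : ℝ => φ (s, 0)) 2 volume :=
  (hφ.continuous.comp (by fun_prop)).memLp_of_hasCompactSupport (hasCompactSupport_slice_right hs 0)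

theorem contDiff_conj (hφ : ContDiff ℝ ∞ φ) : ContDiff ℝ ∞ fun x => conj (φ x) :=
  Complex.conjCLE.contDiff.comp hφ

theorem hasCompactSupport_conj (hs : HasCompactSupport φ) :
    HasCompactSupport fun x => conj (φ x) :=
  hs.comp_left (map_zero _)

theorem IsTrace.green_conj (h : IsTrace u v₂ g) (hφ : ContDiff ℝ ∞ φ) (hs : HasCompactSupport φ) :
    ∫ s : ℝ, g s * conj (φ (s, 0)) =
      -(∫ x, v₂ x * conj (φ x) ∂vol) - ∫ x, u x * conj (D₂ φ x) ∂vol := by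
  have := h.green _ (contDiff_conj hφ) (hasCompactSupport_conj hs)
  simp only [pd₂_conj_add hφ] at this
  rw [this]; ring

theorem dense_smooth_toLp : Dense {p : Lp ℂ 2 (volume : Measure ℝ) |
    ∃ (f : ℝ → ℂ) (hf : MemLp f 2 volume), ContDiff ℝ ∞ f ∧ HasCompactSupport f ∧
      p = hf.toLp f} := by
  refine (Lp.dense_hasCompactSupport_contDiff (F := ℂ) (μ := (volume : Measure ℝ)) (p := 2)
    (by norm_num)).mono ?_
  rintro p ⟨f, hpf, hs, hf⟩
  have hm : MemLp f 2 (volume : Measure ℝ) := hf.continuous.memLp_of_hasCompactSupport hs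
  exact ⟨f, hm, hf, hs, Lp.ext (hpf.trans hm.coeFn_toLp.symm)⟩

/-- Through such extensions, Green's formula tests the trace against every smooth compactly
supported boundary function. -/
theorem exists_extension {f : ℝ → ℂ} (hf : ContDiff ℝ ∞ f) (hs : HasCompactSupport f) :
    ∃ φ : ℝ × ℝ → ℂ, ContDiff ℝ ∞ φ ∧ HasCompactSupport φ ∧ ∀ s, φ (s, 0) = f s := by
  let b : ContDiffBump (0 : ℝ) := ⟨1, 2, one_pos, one_lt_two⟩
  refine ⟨fun x => f x.1 * (b x.2 : ℂ), (hf.comp contDiff_fst).mul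
    (Complex.ofRealCLM.contDiff.comp (b.contDiff.comp contDiff_snd)), ?_, fun s => ?_⟩
  · refine HasCompactSupport.of_support_subset_isCompact (hs.isCompact.prod b.hasCompactSupport) ?_
    intro x hx
    have h1 : f x.1 ≠ 0 := fun h => hx (by simp [h])
    have h2 : b x.2 ≠ 0 := fun h => hx (by simp [h])
    exact ⟨subset_tsupport _ h1, subset_tsupport _ h2⟩
  · have : b 0 = 1 := b.one_of_mem_closedBall (by simp [b])
    simp [this]

/-- The `L²` norm of the trace, as the limit along approximating test functions, together with its
expression through the interior values. -/
theorem trace_norm_sq (h : MemMagneticH1 u v₁ v₂) (ht : IsTrace u v₂ g) {φ : ℕ → ℝ × ℝ → ℂ}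
    (hφ : ∀ n, ContDiff ℝ ∞ (φ n)) (hs : ∀ n, HasCompactSupport (φ n))
    (hu : Tendsto (fun n => eLpNorm (φ n - u) 2 vol) atTop (𝓝 0))
    (hv : Tendsto (fun n => eLpNorm (D₂ (φ n) - v₂) 2 vol) atTop (𝓝 0)) :
    Tendsto (fun n => ∫ s : ℝ, ‖φ n (s, 0)‖ ^ 2) atTop (𝓝 (∫ s : ℝ, ‖g s‖ ^ 2)) ∧
      ((∫ s : ℝ, ‖g s‖ ^ 2 : ℝ) : ℂ) =
        -(∫ x, v₂ x * conj (u x) ∂vol) - ∫ x, u x * conj (v₂ x) ∂vol := by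
  have mφ := fun n => memLp_test (hφ n) (hs n)
  have mD := fun n => memLp_D₂_test (hφ n) (hs n)
  have mb := fun n => memLp_boundary_test (hφ n) (hs n)
  have trφ := fun n => isTrace_of_contDiff ((hφ n).of_le (by exact_mod_cast le_top)) (mb n)
  have const0 : ∀ f : ℝ × ℝ → ℂ, Tendsto (fun _ : ℕ => eLpNorm (f - f) 2 vol) atTop (𝓝 0) :=
    fun f => by simp
  set L : ℂ := -(∫ x, v₂ x * conj (u x) ∂vol) - ∫ x, u x * conj (v₂ x) ∂vol with hL
  -- Green's formula for φₙ paired with itself.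
  have lim1 : Tendsto (fun n => ((∫ s : ℝ, ‖φ n (s, 0)‖ ^ 2 : ℝ) : ℂ)) atTop (𝓝 L) := by
    refine (((tendsto_integral_mul_conj mD h.memLp₂ hv mφ h.memLp hu).neg).sub
      (tendsto_integral_mul_conj mφ h.memLp hu mD h.memLp₂ hv)).congr fun n => ?_
    rw [← (trφ n).green_conj (hφ n) (hs n), ← integral_complex_ofReal]
    simp only [Complex.mul_conj, Complex.normSq_eq_norm_sq]
  -- Green's formula for u paired with φₙ has the same limit.
  have lim2 : Tendsto (fun n => ∫ s : ℝ, g s * conj (φ n (s, 0))) atTop (𝓝 L) := by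
    refine (((tendsto_integral_mul_conj (fun _ => h.memLp₂) h.memLp₂ (const0 _) mφ h.memLp hu).neg).sub
      (tendsto_integral_mul_conj (fun _ => h.memLp) h.memLp (const0 _) mD h.memLp₂ hv)).congr
      fun n => ?_
    rw [← ht.green_conj (hφ n) (hs n)]
  set x : ℕ → Lp ℂ 2 (volume : Measure ℝ) := fun n => (mb n).toLp _ with hx
  set G := ht.memLp.toLp g with hG
  have lim1' : Tendsto (fun n => ‖x n‖ ^ 2) atTop (𝓝 L.re) := by
    have := (Complex.continuous_re.tendsto L).comp lim1
    refine this.congr fun n => ?_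
    simp only [hx, norm_sq_toLp_eq, Function.comp, Complex.ofReal_re]
  obtain ⟨M, hM⟩ : ∃ M, ∀ n, ‖x n‖ ≤ M := by
    obtain ⟨C, hC⟩ := lim1'.bddAbove_range
    refine ⟨C + 1, fun n => ?_⟩
    have := hC ⟨n, rfl⟩
    simp only at this
    nlinarith [sq_nonneg (‖x n‖ - 1)]
  -- The boundary values are bounded by `lim1'`, so weak convergence to g need only be checked
  -- against smooth boundary data, where Green's formula applies.
  have weak : ∀ q, Tendsto (fun n => inner ℂ q (x n)) atTop (𝓝 (inner ℂ q G)) := by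
    refine tendsto_inner_of_dense dense_smooth_toLp hM ?_
    rintro p ⟨f, hf, hfd, hfs, rfl⟩
    obtain ⟨ψ, hψ, hψs, hψf⟩ := exists_extension hfd hfs
    simp only [hx, hG, inner_toLp_eq, ← hψf]
    rw [ht.green_conj hψ hψs]
    simp only [(trφ _).green_conj hψ hψs]
    exact ((tendsto_integral_mul_conj mD h.memLp₂ hv (fun _ => memLp_test hψ hψs)
      (memLp_test hψ hψs) (const0 _)).neg).sub
      (tendsto_integral_mul_conj mφ h.memLp hu (fun _ => memLp_D₂_test hψ hψs)
        (memLp_D₂_test hψ hψs) (const0 _))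
  have lim3 : Tendsto (fun n => inner ℂ (x n) G) atTop (𝓝 (inner ℂ G G)) := by
    have := (Complex.continuous_conj.tendsto _).comp (weak G)
    simpa only [Function.comp_def, inner_conj_symm] using this
  -- The pairings of the boundary values with g tend to ‖g‖² by weak convergence and to L by `lim2`.
  have hLG : L = ((∫ s : ℝ, ‖g s‖ ^ 2 : ℝ) : ℂ) := by
    have e : ∀ n, inner ℂ (x n) G = ∫ s : ℝ, g s * conj (φ n (s, 0)) := fun n =>
      inner_toLp_eq _ _
    simp only [e] at lim3
    rw [tendsto_nhds_unique lim2 lim3, inner_self_eq_norm_sq_to_K, ← norm_sq_toLp_eq ht.memLp]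
    norm_cast
  refine ⟨?_, hLG.symm⟩
  have := (Complex.continuous_re.tendsto L).comp lim1
  rw [hLG] at this
  exact this

/-- Integration by parts up to the boundary. -/
theorem trace_identity (h : MemMagneticH1 u v₁ v₂) (ht : IsTrace u v₂ g) :
    ∫ s : ℝ, ‖g s‖ ^ 2 = -2 * (∫ x, v₂ x * conj (u x) ∂vol).re := by
  obtain ⟨φ, hφ, hs, l0, -, l2⟩ := exists_seq_approx h
  have key := congrArg Complex.re (trace_norm_sq h ht hφ hs l0 l2).2
  have hc : ∫ x, u x * conj (v₂ x) ∂vol = conj (∫ x, v₂ x * conj (u x) ∂vol) := by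
    rw [← integral_conj]
    congr 1; ext x; simp [mul_comm]
  rw [hc] at key
  simp only [Complex.ofReal_re, Complex.sub_re, Complex.neg_re, Complex.conj_re] at key
  linarith

theorem integrable_norm_sq {α : Type*} [MeasurableSpace α] {μ : Measure α} {f : α → ℂ}
    (hf : MemLp f 2 μ) : Integrable (fun x => ‖f x‖ ^ 2) μ :=
  hf.integrable_norm_pow (by norm_num)

/-- Lower bound of the quadratic form by `-γ²`. -/
theorem neg_sq_le_form (h : MemMagneticH1 u v₁ v₂) (ht : IsTrace u v₂ g) (γ : ℝ) :
    -γ ^ 2 * ∫ x, ‖u x‖ ^ 2 ∂vol ≤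
      (∫ x, (‖v₁ x‖ ^ 2 + ‖v₂ x‖ ^ 2) ∂vol) + γ * ∫ s : ℝ, ‖g s‖ ^ 2 := by
  rw [integral_add (integrable_norm_sq h.memLp₁) (integrable_norm_sq h.memLp₂), trace_identity h ht,
    ← norm_sq_toLp_eq h.memLp, ← norm_sq_toLp_eq h.memLp₂, ← inner_toLp_eq h.memLp h.memLp₂]
  have h1 : 0 ≤ ∫ x, ‖v₁ x‖ ^ 2 ∂vol := integral_nonneg fun x => by positivity
  -- The cross term of this square is γ times the boundary integral, by the trace identity.
  have h2 := sq_nonneg ‖h.memLp₂.toLp v₂ - (γ : ℂ) • h.memLp.toLp u‖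
  rw [@norm_sub_sq ℂ, norm_smul, inner_smul_right, mul_pow, Complex.norm_real, Real.norm_eq_abs,
    sq_abs, ← inner_conj_symm] at h2
  simp only [RCLike.re_to_complex, Complex.re_ofReal_mul, Complex.conj_re] at h2
  linarith

/-- Lower bound of the quadratic form for large positive `γ`. -/
theorem form_lower_bound (h : MemMagneticH1 u v₁ v₂) (ht : IsTrace u v₂ g) {γ : ℝ} (hγ : 1 ≤ γ) :
    (1 - 4 * γ * Real.exp (-γ ^ 2)) * ∫ x, ‖u x‖ ^ 2 ∂vol ≤
      (∫ x, (‖v₁ x‖ ^ 2 + ‖v₂ x‖ ^ 2) ∂vol) + γ * ∫ s : ℝ, ‖g s‖ ^ 2 := by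
  obtain ⟨φ, hφ, hs, l0, l1, l2⟩ := exists_seq_approx h
  have m0 := fun n => memLp_test (hφ n) (hs n)
  have m1 := fun n => memLp_D₁_test (hφ n) (hs n)
  have m2 := fun n => memLp_D₂_test (hφ n) (hs n)
  have hT := (trace_norm_sq h ht hφ hs l0 l2).1
  rw [integral_add (integrable_norm_sq h.memLp₁) (integrable_norm_sq h.memLp₂)]
  refine le_of_tendsto_of_tendsto' ((tendsto_integral_norm_sq m0 h.memLp l0).const_mul _)
    (((tendsto_integral_norm_sq m1 h.memLp₁ l1).add (tendsto_integral_norm_sq m2 h.memLp₂ l2)).add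
      (hT.const_mul γ)) fun n => ?_
  rw [← integral_add (integrable_norm_sq (m1 n)) (integrable_norm_sq (m2 n))]
  exact magnetic_bound_of_contDiff hγ (hφ n) (hs n)

end Trace

/-! ### Wave packets and upper bounds -/

section TestFunctions

theorem integrable_sq_mul_exp_neg_mul_sq {b : ℝ} (hb : 0 < b) :
    Integrable fun s : ℝ => s ^ 2 * Real.exp (-b * s ^ 2) := by
  have := integrable_rpow_mul_exp_neg_mul_sq hb (s := 2) (by norm_num)
  simpa only [Real.rpow_ofNat] using this

theorem hasDerivAt_mul_exp_neg_mul_sq (b s : ℝ) :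
    HasDerivAt (fun s : ℝ => s * Real.exp (-b * s ^ 2))
      (Real.exp (-b * s ^ 2) - 2 * b * (s ^ 2 * Real.exp (-b * s ^ 2))) s := by
  have := (hasDerivAt_id s).mul ((((hasDerivAt_id s).pow 2).const_mul (-b)).exp)
  refine this.congr_deriv ?_
  simp
  ring

theorem integral_sq_mul_exp_neg_mul_sq {b : ℝ} (hb : 0 < b) :
    2 * b * ∫ s : ℝ, s ^ 2 * Real.exp (-b * s ^ 2) = ∫ s : ℝ, Real.exp (-b * s ^ 2) := by
  have h0 := integrable_exp_neg_mul_sq hb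
  have h2 := (integrable_sq_mul_exp_neg_mul_sq hb).const_mul (2 * b)
  have := integral_eq_zero_of_hasDerivAt_of_integrable (hasDerivAt_mul_exp_neg_mul_sq b)
    (h0.sub h2) (integrable_mul_exp_neg_mul_sq hb)
  rw [integral_sub h0 h2, integral_const_mul] at this
  linarith

/-- The phase relating the symmetric gauge to the plane wave of frequency `ξ` in the Landau
gauge. -/
def wavePhase (ξ : ℝ) (x : ℝ × ℝ) : ℝ := x.1 * x.2 / 2 + ξ * x.1

/-- Wave packets, with a Gaussian tangential envelope of width `ε ^ (-1/2)` and normal profile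
`g`. -/
def wavePacket (ε ξ : ℝ) (g : ℝ → ℝ) (x : ℝ × ℝ) : ℂ :=
  Complex.exp (wavePhase ξ x * Complex.I) * ((Real.exp (-ε * x.1 ^ 2) * g x.2 : ℝ) : ℂ)

variable {ε ξ : ℝ} {g g' : ℝ → ℝ}

theorem contDiff_wavePacket (hg : ContDiff ℝ 1 g) : ContDiff ℝ 1 (wavePacket ε ξ g) := by
  have h1 : ContDiff ℝ 1 (wavePhase ξ) := by unfold wavePhase; fun_prop
  have h2 : ContDiff ℝ 1 fun x : ℝ × ℝ => Real.exp (-ε * x.1 ^ 2) * g x.2 :=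
    (by fun_prop : ContDiff ℝ 1 fun x : ℝ × ℝ => Real.exp (-ε * x.1 ^ 2)).mul
      (hg.comp contDiff_snd)
  exact ((Complex.ofRealCLM.contDiff.comp h1).mul contDiff_const).cexp.mul
    (Complex.ofRealCLM.contDiff.comp h2)

theorem D₁_wavePacket (hg : ContDiff ℝ 1 g) (x : ℝ × ℝ) :
    D₁ (wavePacket ε ξ g) x = Complex.exp (wavePhase ξ x * Complex.I) *
      (((-2 * ε * x.1 : ℝ) + ((ξ + x.2 : ℝ) : ℂ) * Complex.I) *
        ((Real.exp (-ε * x.1 ^ 2) * g x.2 : ℝ) : ℂ)) := by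
  have h1 := hasDerivAt_pd₁ ((contDiff_wavePacket (ε := ε) (ξ := ξ) hg).differentiable one_ne_zero)
    x.1 x.2
  have hθ : HasDerivAt (fun s : ℝ => wavePhase ξ (s, x.2)) (x.2 / 2 + ξ) x.1 := by
    refine ((((hasDerivAt_id x.1).mul_const x.2).div_const 2).add
      ((hasDerivAt_id x.1).const_mul ξ)).congr_deriv (by ring)
  have hf : HasDerivAt (fun s : ℝ => Real.exp (-ε * s ^ 2) * g x.2)
      (-2 * ε * x.1 * (Real.exp (-ε * x.1 ^ 2) * g x.2)) x.1 := by
    refine ((((hasDerivAt_id x.1).pow 2).const_mul (-ε)).exp.mul_const (g x.2)).congr_deriv ?_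
    simp
    ring
  have h2 := ((hθ.ofReal_comp.mul_const Complex.I).cexp).mul hf.ofReal_comp
  rw [D₁, h1.unique h2, A₁, wavePacket]
  push_cast
  ring

theorem D₂_wavePacket (hg : ContDiff ℝ 1 g) (hg' : ∀ t, HasDerivAt g (g' t) t) (x : ℝ × ℝ) :
    D₂ (wavePacket ε ξ g) x = Complex.exp (wavePhase ξ x * Complex.I) *
      ((Real.exp (-ε * x.1 ^ 2) * g' x.2 : ℝ) : ℂ) := by
  have h1 := hasDerivAt_pd₂ ((contDiff_wavePacket (ε := ε) (ξ := ξ) hg).differentiable one_ne_zero)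
    x.1 x.2
  have hθ : HasDerivAt (fun s : ℝ => wavePhase ξ (x.1, s)) (x.1 / 2) x.2 := by
    refine ((((hasDerivAt_id x.2).const_mul x.1).div_const 2).add_const (ξ * x.1)).congr_deriv
      (by ring)
  have hf := (hg' x.2).const_mul (Real.exp (-ε * x.1 ^ 2))
  have h2 := ((hθ.ofReal_comp.mul_const Complex.I).cexp).mul hf.ofReal_comp
  rw [D₂, h1.unique h2, A₂, wavePacket]
  push_cast
  ring

theorem exp_neg_mul_sq_sq (ε s : ℝ) :
    Real.exp (-ε * s ^ 2) ^ 2 = Real.exp (-(2 * ε) * s ^ 2) := by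
  rw [← Real.exp_nat_mul]; congr 1; push_cast; ring

theorem norm_sq_wavePacket (x : ℝ × ℝ) :
    ‖wavePacket ε ξ g x‖ ^ 2 = Real.exp (-(2 * ε) * x.1 ^ 2) * g x.2 ^ 2 := by
  rw [wavePacket, norm_exp_ofReal_mul_I_mul, Complex.norm_real, Real.norm_eq_abs, sq_abs, mul_pow,
    exp_neg_mul_sq_sq]

theorem norm_sq_D₁_wavePacket (hg : ContDiff ℝ 1 g) (x : ℝ × ℝ) :
    ‖D₁ (wavePacket ε ξ g) x‖ ^ 2 =
      (4 * ε ^ 2) * ((x.1 ^ 2 * Real.exp (-(2 * ε) * x.1 ^ 2)) * g x.2 ^ 2)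
      + Real.exp (-(2 * ε) * x.1 ^ 2) * ((x.2 + ξ) ^ 2 * g x.2 ^ 2) := by
  rw [D₁_wavePacket hg, norm_exp_ofReal_mul_I_mul, norm_mul, Complex.norm_real, Real.norm_eq_abs,
    mul_pow, sq_abs, mul_pow, exp_neg_mul_sq_sq, Complex.sq_norm, Complex.normSq_add_mul_I]
  ring

theorem norm_sq_D₂_wavePacket (hg : ContDiff ℝ 1 g) (hg' : ∀ t, HasDerivAt g (g' t) t)
    (x : ℝ × ℝ) : ‖D₂ (wavePacket ε ξ g) x‖ ^ 2 = Real.exp (-(2 * ε) * x.1 ^ 2) * g' x.2 ^ 2 := by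
  rw [D₂_wavePacket hg hg', norm_exp_ofReal_mul_I_mul, Complex.norm_real, Real.norm_eq_abs, sq_abs,
    mul_pow, exp_neg_mul_sq_sq]

theorem integrable_mul_prod_vol {f h : ℝ → ℝ} (hf : Integrable f)
    (hh : IntegrableOn h (Ioi 0)) : Integrable (fun x : ℝ × ℝ => f x.1 * h x.2) vol := by
  rw [vol_eq_prod]; exact hf.mul_prod hh

theorem integral_mul_prod_vol (f h : ℝ → ℝ) :
    ∫ x : ℝ × ℝ, f x.1 * h x.2 ∂vol = (∫ s, f s) * ∫ t in Ioi (0 : ℝ), h t := by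
  rw [vol_eq_prod]; exact integral_prod_mul f h

/-- The Rayleigh quotients of wave packets. -/
theorem wavePacket_quotient_mem (γ : ℝ) (hε : 0 < ε) (hg : ContDiff ℝ 1 g)
    (hg' : ∀ t, HasDerivAt g (g' t) t) (i0 : IntegrableOn (fun t => g t ^ 2) (Ioi 0))
    (i1 : IntegrableOn (fun t => g' t ^ 2) (Ioi 0))
    (i2 : IntegrableOn (fun t => (t + ξ) ^ 2 * g t ^ 2) (Ioi 0))
    (hN : 0 < ∫ t in Ioi (0 : ℝ), g t ^ 2) :
    ε + ((∫ t in Ioi (0 : ℝ), g' t ^ 2) + (∫ t in Ioi (0 : ℝ), (t + ξ) ^ 2 * g t ^ 2)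
      + γ * g 0 ^ 2) / (∫ t in Ioi (0 : ℝ), g t ^ 2) ∈ rayleighQuotients γ := by
  set u := wavePacket ε ξ g with hu
  have hud : ContDiff ℝ 1 u := contDiff_wavePacket hg
  have h2ε : 0 < 2 * ε := by positivity
  have j0 := integrable_exp_neg_mul_sq h2ε
  have j2 := integrable_sq_mul_exp_neg_mul_sq h2ε
  set F := ∫ s : ℝ, Real.exp (-(2 * ε) * s ^ 2) with hF
  have hF0 : 0 < F := by rw [hF, integral_gaussian]; positivity
  -- The tangential kinetic energy of the Gaussian envelope, relative to its mass F, is ε; this is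
  -- the additive ε in the quotient.
  have hF2 : (4 * ε ^ 2) * ∫ s : ℝ, s ^ 2 * Real.exp (-(2 * ε) * s ^ 2) = ε * F := by
    rw [hF, ← integral_sq_mul_exp_neg_mul_sq h2ε]; ring
  have k0 := integrable_mul_prod_vol j0 i0
  have k1 := integrable_mul_prod_vol j0 i1
  have k2 := integrable_mul_prod_vol j0 i2
  have k3 := (integrable_mul_prod_vol j2 i0).const_mul (4 * ε ^ 2)
  have m0 : MemLp u 2 vol := by
    rw [memLp_two_iff_integrable_sq_norm hud.continuous.aestronglyMeasurable]
    simpa only [hu, norm_sq_wavePacket] using k0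
  have m1 : MemLp (D₁ u) 2 vol := by
    rw [memLp_two_iff_integrable_sq_norm (continuous_D₁ hud).aestronglyMeasurable]
    simp only [hu, norm_sq_D₁_wavePacket hg]
    exact k3.add k2
  have m2 : MemLp (D₂ u) 2 vol := by
    rw [memLp_two_iff_integrable_sq_norm (continuous_D₂ hud).aestronglyMeasurable]
    simpa only [hu, norm_sq_D₂_wavePacket hg hg'] using k1
  have mb : MemLp (fun s : ℝ => u (s, 0)) 2 volume := by
    have huc := hud.continuous
    rw [memLp_two_iff_integrable_sq_norm
      (by fun_prop : Continuous fun s : ℝ => u (s, 0)).aestronglyMeasurable]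
    simpa only [hu, norm_sq_wavePacket] using j0.mul_const (g 0 ^ 2)
  have n0 : ∫ x, ‖u x‖ ^ 2 ∂vol = F * ∫ t in Ioi (0 : ℝ), g t ^ 2 := by
    simp only [hu, norm_sq_wavePacket]
    exact integral_mul_prod_vol (fun s => Real.exp (-(2 * ε) * s ^ 2)) fun t => g t ^ 2
  have n1 : ∫ x, ‖D₁ u x‖ ^ 2 ∂vol = ε * F * (∫ t in Ioi (0 : ℝ), g t ^ 2)
      + F * ∫ t in Ioi (0 : ℝ), (t + ξ) ^ 2 * g t ^ 2 := by
    simp only [hu, norm_sq_D₁_wavePacket hg]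
    rw [integral_add k3 k2, integral_const_mul,
      integral_mul_prod_vol (fun s => s ^ 2 * Real.exp (-(2 * ε) * s ^ 2)) fun t => g t ^ 2,
      integral_mul_prod_vol (fun s => Real.exp (-(2 * ε) * s ^ 2)) fun t => (t + ξ) ^ 2 * g t ^ 2,
      ← hF2]
    ring
  have n2 : ∫ x, ‖D₂ u x‖ ^ 2 ∂vol = F * ∫ t in Ioi (0 : ℝ), g' t ^ 2 := by
    simp only [hu, norm_sq_D₂_wavePacket hg hg']
    exact integral_mul_prod_vol (fun s => Real.exp (-(2 * ε) * s ^ 2)) fun t => g' t ^ 2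
  have nb : ∫ s : ℝ, ‖u (s, 0)‖ ^ 2 = F * g 0 ^ 2 := by
    simp only [hu, norm_sq_wavePacket]
    exact integral_mul_const _ _
  refine ⟨u, D₁ u, D₂ u, fun s => u (s, 0), memMagneticH1_of_contDiff hud m0 m1 m2,
    isTrace_of_contDiff hud mb, fun h0 => ?_, ?_⟩
  · have : ∫ x, ‖u x‖ ^ 2 ∂vol = 0 :=
      integral_eq_zero_of_ae (h0.mono fun x hx => by simp [hx])
    rw [n0] at this
    exact (mul_pos hF0 hN).ne' this
  · rw [integral_add (integrable_norm_sq m1) (integrable_norm_sq m2), n0, n1, n2, nb]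
    field_simp
    ring

/-- Quotients of wave packets with exponential profile. -/
theorem exponential_quotient_mem {γ : ℝ} (hγ : γ < 0) (hε : 0 < ε) :
    ε + (-γ ^ 2 + 1 / (4 * γ ^ 2)) ∈ rayleighQuotients γ := by
  have hγ0 : γ ≠ 0 := hγ.ne
  set E : ℝ → ℝ := fun t => Real.exp (2 * γ * t) with hE
  have hEd : ∀ t, HasDerivAt E (2 * γ * E t) t := fun t => by
    refine (((hasDerivAt_id t).const_mul (2 * γ)).exp).congr_deriv ?_
    simp [hE]; ring
  have hlim : ∀ n : ℕ, Tendsto (fun t : ℝ => t ^ n * E t) atTop (𝓝 0) := fun n => by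
    have hp : Tendsto (fun t : ℝ => (-(2 * γ)) * t) atTop atTop :=
      tendsto_id.const_mul_atTop (by linarith)
    have h := ((Real.tendsto_pow_mul_exp_neg_atTop_nhds_zero n).comp hp).const_mul
      (((-(2 * γ)) ^ n)⁻¹)
    rw [mul_zero] at h
    refine h.congr fun t => ?_
    have : (-(2 * γ)) ^ n ≠ 0 := pow_ne_zero _ (by simpa using hγ0)
    simp only [Function.comp, hE, mul_pow]
    field_simp
  have hsq : ∀ t, Real.exp (γ * t) ^ 2 = E t := fun t => by
    rw [← Real.exp_nat_mul]; congr 1; push_cast; ring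
  have d0 : ∀ t ∈ Ici (0 : ℝ), HasDerivAt (fun t => E t / (2 * γ)) (E t) t := fun t _ =>
    ((hEd t).div_const (2 * γ)).congr_deriv (by field_simp)
  -- The shift 1/(2γ) makes the antiderivative this simple: -1/(2γ) is the mean of the density
  -- proportional to exp(2γt) on (0, ∞), and 1/(4γ²) is its variance.
  have d2 : ∀ t ∈ Ici (0 : ℝ), HasDerivAt
      (fun t => (t ^ 2 * E t) / (2 * γ) + E t / (2 * γ) ^ 3)
      ((t + 1 / (2 * γ)) ^ 2 * E t) t := fun t _ => by
    refine ((((hasDerivAt_id t).pow 2).mul (hEd t)).div_const (2 * γ) |>.add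
      ((hEd t).div_const ((2 * γ) ^ 3))).congr_deriv ?_
    simp
    field_simp
    ring
  have l0 : Tendsto (fun t => E t / (2 * γ)) atTop (𝓝 0) := by
    simpa using (hlim 0).div_const (2 * γ)
  have l2 : Tendsto (fun t => (t ^ 2 * E t) / (2 * γ) + E t / (2 * γ) ^ 3) atTop (𝓝 0) := by
    simpa using ((hlim 2).div_const (2 * γ)).add ((hlim 0).div_const ((2 * γ) ^ 3))
  have p0 : ∀ t ∈ Ioi (0 : ℝ), 0 ≤ E t := fun t _ => (Real.exp_pos _).le
  have p2 : ∀ t ∈ Ioi (0 : ℝ), 0 ≤ (t + 1 / (2 * γ)) ^ 2 * E t := fun t _ =>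
    mul_nonneg (sq_nonneg _) (Real.exp_pos _).le
  have i0 := integrableOn_Ioi_deriv_of_nonneg' d0 p0 l0
  have i2 := integrableOn_Ioi_deriv_of_nonneg' d2 p2 l2
  have v0 := integral_Ioi_of_hasDerivAt_of_nonneg' d0 p0 l0
  have v2 := integral_Ioi_of_hasDerivAt_of_nonneg' d2 p2 l2
  have hE0 : E 0 = 1 := by simp [hE]
  have hg1 : ∀ t, HasDerivAt (fun t => Real.exp (γ * t)) (γ * Real.exp (γ * t)) t := fun t => by
    refine (((hasDerivAt_id t).const_mul γ).exp).congr_deriv ?_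
    simp; ring
  -- The squared profile has mass -1/(2γ), so the normal energy and the boundary term contribute γ²
  -- - 2γ² = -γ², and the potential contributes the variance.
  have key := wavePacket_quotient_mem (g := fun t => Real.exp (γ * t))
    (g' := fun t => γ * Real.exp (γ * t)) (ξ := 1 / (2 * γ)) γ hε (by fun_prop) hg1
    (by simpa only [hsq] using i0)
    (by simp only [mul_pow, hsq]; exact i0.const_mul (γ ^ 2))
    (by simpa only [hsq] using i2)
    (by
      simp only [hsq]
      rw [v0, hE0, zero_sub, Left.neg_pos_iff]
      exact div_neg_of_pos_of_neg one_pos (by linarith))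
  simp only [mul_pow, hsq] at key
  rw [integral_const_mul, v0, v2, hE0] at key
  convert key using 2
  field_simp
  ring

/-- Quotients of wave packets with Gaussian profile centred at `γ + 1`. -/
theorem gaussian_quotient_mem (γ : ℝ) : ∃ a : ℝ, 0 < a ∧
    ∀ ε : ℝ, 0 < ε → ε + (1 - a) ∈ rayleighQuotients γ := by
  -- Integrating the derivative of (t - c)E gives 2∫(t-c)²E = ∫E - cE(0). The form is thus ∫E - (c -
  -- γ)E(0), below ∫E as soon as c > γ; c = γ + 1 makes the gap exactly E(0).
  set c := γ + 1 with hc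
  set E : ℝ → ℝ := fun t => Real.exp (-1 * (t - c) ^ 2) with hE
  have hsq : ∀ t, Real.exp (-(t - c) ^ 2 / 2) ^ 2 = E t := fun t => by
    rw [← Real.exp_nat_mul]; congr 1; push_cast; ring
  have i0 : Integrable E := (integrable_exp_neg_mul_sq one_pos).comp_sub_right c
  have i1 : Integrable fun t => (t - c) * E t :=
    (integrable_mul_exp_neg_mul_sq one_pos).comp_sub_right c
  have i2 : Integrable fun t => (t - c) ^ 2 * E t :=
    (integrable_sq_mul_exp_neg_mul_sq one_pos).comp_sub_right c
  have hd : ∀ t ∈ Ici (0 : ℝ), HasDerivAt (fun t => (t - c) * E t)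
      (E t - 2 * ((t - c) ^ 2 * E t)) t := fun t _ =>
    ((hasDerivAt_mul_exp_neg_mul_sq 1 (t - c)).comp_sub_const t c).congr_deriv (by
      simp only [hE]; ring)
  have id : IntegrableOn (fun t => E t - 2 * ((t - c) ^ 2 * E t)) (Ioi 0) :=
    (i0.sub (i2.const_mul 2)).integrableOn
  have hlim := tendsto_zero_of_hasDerivAt_of_integrableOn_Ioi
    (fun t ht => hd t (Ioi_subset_Ici_self ht)) id i1.integrableOn
  have v := integral_Ioi_of_hasDerivAt_of_tendsto' hd id hlim
  rw [integral_sub i0.integrableOn (i2.const_mul 2).integrableOn, integral_const_mul] at v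
  have hN : 0 < ∫ t in Ioi (0 : ℝ), E t := by
    rw [setIntegral_pos_iff_support_of_nonneg_ae
      (Eventually.of_forall fun t => (Real.exp_pos _).le) i0.integrableOn]
    have : Function.support E = univ := by
      ext t; simp [hE]
    rw [this, univ_inter, Real.volume_Ioi]
    exact ENNReal.zero_lt_top
  have hg1 : ∀ t, HasDerivAt (fun t => Real.exp (-(t - c) ^ 2 / 2))
      (-(t - c) * Real.exp (-(t - c) ^ 2 / 2)) t := fun t => by
    refine ((((((hasDerivAt_id t).sub_const c).pow 2).neg).div_const 2).exp).congr_deriv ?_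
    simp
    ring
  have hE0 : 0 < E 0 := Real.exp_pos _
  refine ⟨E 0 / ∫ t in Ioi (0 : ℝ), E t, div_pos hE0 hN, fun ε hε => ?_⟩
  have key := wavePacket_quotient_mem (g := fun t => Real.exp (-(t - c) ^ 2 / 2))
    (g' := fun t => -(t - c) * Real.exp (-(t - c) ^ 2 / 2)) (ξ := -c) γ hε (by fun_prop) hg1
    (by simpa only [hsq] using i0.integrableOn)
    (by simpa only [mul_pow, hsq, neg_sq] using i2.integrableOn)
    (by simpa only [hsq, ← sub_eq_add_neg] using i2.integrableOn)
    (by simpa only [hsq] using hN)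
  simp only [mul_pow, hsq, neg_sq, ← sub_eq_add_neg] at key
  convert key using 2
  rw [eq_div_iff hN.ne', sub_mul, div_mul_cancel₀ _ hN.ne']
  rw [zero_sub] at v
  rw [hc] at v ⊢
  linarith

end TestFunctions

/-! ### From bounds on the form to bounds on the infimum -/

theorem integral_norm_sq_pos {u : ℝ × ℝ → ℂ} (hu : MemLp u 2 vol) (h0 : ¬ (u =ᵐ[vol] 0)) :
    0 < ∫ x, ‖u x‖ ^ 2 ∂vol := by
  rw [← norm_sq_toLp_eq hu]
  refine pow_pos (norm_pos_iff.2 fun h => h0 ?_) 2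
  exact hu.coeFn_toLp.symm.trans ((Lp.eq_zero_iff_ae_eq_zero).1 h)

theorem neg_sq_mem_lowerBounds (γ : ℝ) : -γ ^ 2 ∈ lowerBounds (rayleighQuotients γ) := by
  rintro r ⟨u, v₁, v₂, g, h, ht, h0, rfl⟩
  rw [le_div_iff₀ (integral_norm_sq_pos h.memLp h0)]
  exact neg_sq_le_form h ht γ

theorem rayleighQuotients_nonempty (γ : ℝ) : (rayleighQuotients γ).Nonempty := by
  obtain ⟨a, -, ha⟩ := gaussian_quotient_mem γ
  exact ⟨_, ha 1 one_pos⟩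

/-- The bound from below is essential: `sInf` of a real set unbounded below is 0 by convention and
would not lie under its elements. -/
theorem Theta_le_of_forall_add_mem {γ q : ℝ} (h : ∀ ε : ℝ, 0 < ε → ε + q ∈ rayleighQuotients γ) :
    Theta γ ≤ q :=
  le_of_forall_pos_le_add fun ε hε => by
    rw [add_comm]; exact csInf_le ⟨_, neg_sq_mem_lowerBounds γ⟩ (h ε hε)

end RobinHalfPlane

end

theorem mainTheorem9 :
    (∀ γ : ℝ, (RobinHalfPlane.rayleighQuotients γ).Nonempty ∧
      BddBelow (RobinHalfPlane.rayleighQuotients γ)) ∧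
    ∃ C₀ γ₀ : ℝ, 0 < C₀ ∧ 0 < γ₀ ∧
      (∀ γ : ℝ, γ₀ ≤ γ →
        1 - C₀ * γ * Real.exp (-γ ^ 2) ≤ RobinHalfPlane.Theta γ ∧ RobinHalfPlane.Theta γ < 1) ∧
      (∀ γ : ℝ, γ < 0 →
        -γ ^ 2 ≤ RobinHalfPlane.Theta γ ∧
          RobinHalfPlane.Theta γ ≤ -γ ^ 2 + 1 / (4 * γ ^ 2)) := by
  -- The constants C₀ = 4 and γ₀ = 1 are those of the oscillator bound.
  refine ⟨fun γ => ⟨RobinHalfPlane.rayleighQuotients_nonempty γ,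
    _, RobinHalfPlane.neg_sq_mem_lowerBounds γ⟩, 4, 1, by norm_num, one_pos,
    fun γ hγ => ⟨?_, ?_⟩, fun γ hγ => ⟨?_, ?_⟩⟩
  · refine le_csInf (RobinHalfPlane.rayleighQuotients_nonempty γ) ?_
    rintro r ⟨u, v₁, v₂, g, h, ht, h0, rfl⟩
    rw [le_div_iff₀ (RobinHalfPlane.integral_norm_sq_pos h.memLp h0)]
    exact RobinHalfPlane.form_lower_bound h ht hγ
  · obtain ⟨a, ha, hmem⟩ := RobinHalfPlane.gaussian_quotient_mem γ
    exact (RobinHalfPlane.Theta_le_of_forall_add_mem hmem).trans_lt (by linarith)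
  · exact le_csInf (RobinHalfPlane.rayleighQuotients_nonempty γ)
      (RobinHalfPlane.neg_sq_mem_lowerBounds γ)
  · exact RobinHalfPlane.Theta_le_of_forall_add_mem fun ε hε =>
      RobinHalfPlane.exponential_quotient_mem hγ hε
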